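/- Let $n\ge 1$ and let $\mathcal C_n=\{1<\cdots<n<\overline n<\cdots<\overline 1\}$. A column $C$ is a finite strictly increasing sequence of letters of $\mathcal C_n$, written from top to bottom. Let $z_1>\dots>z_r$ be the unbarred letters $z$ with $z,\overline z\in C$. The column $C$ is admissible if there are unbarred letters $t_1>\dots>t_r$ such that, for each $k$, $t_k$ is the greatest unbarred letter with $t_k<z_k$, $t_k<t_{k-1}$ (if $k\ge 2$), $t_k\notin C$ and $\overline{t_k}\notin C$. Then $rC$ (resp. $lC$) is the column obtained from $C$ by changing every $\overline{z_k}$ into $\overline{t_k}$ (resp. every $z_k$ into $t_k$) and reordering. For columns $C,C'$ write $C\le C'$ if $C$ is at least as high as $C'$ and the rows of $CC'$ weakly increase. Let $\lambda=\sum_{p=1}^n\lambda_p\Lambda_p$ with $\lambda_p\in\mathbb N$, and let $Y(\lambda)$ be the Young diagram with $\lambda_p$ columns of height $p$ for $p=1,\dots,n$. A symplectic tableau of shape $\lambda$ is a filling $T=C_1\cdots C_l$ of $Y(\lambda)$ whose columns $C_j$ are admissible and satisfy $rC_j\le lC_{j+1}$ for $1\le j<l$; the set of these is denoted $\mathbf{ST}(n,\lambda)$.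 The reading $\mathrm w(T)$ is the word obtained by reading the columns from right to left, each from top to bottom. A column of height $p$ is of highest weight if its letters are $1,\dots,p$, and $T_\lambda$ is the filling of $Y(\lambda)$ all of whose columns are of highest weight. A letter $x\neq 1$ of a column $C$ is movable if the predecessor of $x$ in $\mathcal C_n$ is not in $C$. For $1\le i<n$ let $M_i=\{\overline i,i+1\}$ and $P_i=\{\overline{i+1},i\}$, and let $M_n=\{\overline n\}$ and $P_n=\{n\}$. Let $T=C_1\cdots C_l\in\mathbf{ST}(n,\lambda)$ with $T\ne T_\lambda$. Let $C_k$ be the rightmost column of $T$ that is not of highest weight, $x$ the smallest movable letter of $C_k$, and $i\in\{1,\dots,n\}$ the index with $x\in M_i$. Let $y$ be the rightmost letter of $\mathrm w(T)$, at or after the occurrence of $x$ in $C_k$, such that $y\in M_i$ and the factor $x\cdots y$ of $\mathrm w(T)$ contains no letter of $P_i$. Let $r$ be the number of letters of $M_i$ in $x\cdots y$, and let $T_1$ be the filling of $Y(\lambda)$ obtained from $T$ by changing, in $x\cdots y$, each letter $\overline i$ into $\overline{i+1}$ and each letter $i+1$ into $i$ if $i\ne n$, and each letter $\overline n$ into $n$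 if $i=n$. Then $i$, $r$ and $T_1$ are well defined and uniquely determined by $T$, and $T_1\in\mathbf{ST}(n,\lambda)$. Consequently, for every $T\in\mathbf{ST}(n,\lambda)$, the algorithm that repeats this step until the tableau $T_\lambda$ is obtained is well defined and reaches $T_\lambda$ after finitely many steps; in particular it assigns to $T$ a unique finite sequence $(i_1,r_1),\dots,(i_s,r_s)$. -/

import Mathlib

namespace SymplecticTableaux

/-- The alphabet `1 < ⋯ < n < n̄ < ⋯ < 1̄`. The letters are numbered from `0`: the element
`j : Fin n` stands for the number `j + 1`. -/
inductive Letter (n : ℕ) : Type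
  | unbarred (j : Fin n) : Letter n
  | barred (j : Fin n) : Letter n

namespace Letter

variable {n : ℕ}

/-- Position of a letter in the alphabet, counted from `0`. -/
def rank : Letter n → ℕ
  | unbarred j => j.val
  | barred j => 2 * n - 1 - j.val

theorem rank_injective : Function.Injective (rank (n := n)) := by
  rintro (⟨a, ha⟩ | ⟨a, ha⟩) (⟨b, hb⟩ | ⟨b, hb⟩) h <;> simp only [rank] at h
  · subst h; rfl
  · omega
  · omega
  · have hab : a = b := by omega
    subst hab; rfl

instance : LinearOrder (Letter n) := LinearOrder.lift' rank rank_injective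

/-- The operator `ẽᵢ` on the crystal `1 → 2 → ⋯ → n → n̄ → ⋯ → 1̄` of the vector representation:
`i + 1 ↦ i`, `ī ↦ (i+1)‾` for `i < n`, and `n̄ ↦ n` for `i = n`; the value `none` is `0`. -/
def eTilde (i : Fin n) : Letter n → Option (Letter n)
  | unbarred j => if j.val = i.val + 1 then some (unbarred i) else none
  | barred j =>
      if j = i then
        if h : i.val + 1 < n then some (barred ⟨i.val + 1, h⟩) else some (unbarred i)
      else none

/-- The letter belongs to `{ī, i+1}` (to `{n̄}` if `i = n`). -/
def IsMinus (i : Fin n) : Letter n → Prop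
  | unbarred j => j.val = i.val + 1
  | barred j => j = i

/-- The letter belongs to `{(i+1)‾, i}` (to `{n}` if `i = n`). -/
def IsPlus (i : Fin n) : Letter n → Prop
  | unbarred j => j = i
  | barred j => j.val = i.val + 1

instance (i : Fin n) : DecidablePred (IsMinus i) := fun x =>
  match x with
  | unbarred j => inferInstanceAs (Decidable (j.val = i.val + 1))
  | barred j => inferInstanceAs (Decidable (j = i))

end Letter

open Letter

variable {n : ℕ}

/-- A column, as the list of its letters from top to bottom; this list is also its reading. -/
def IsColumn (C : List (Letter n)) : Prop := C.Pairwise (· < ·)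

/-- The unbarred letters `z₁ > ⋯ > z_r` such that the pair `(z, z̄)` occurs in `C`. -/
def pairLetters (C : List (Letter n)) : List (Fin n) :=
  (List.finRange n).reverse.filter fun z => unbarred z ∈ C ∧ barred z ∈ C

/-- `J` is the list `t₁ > ⋯ > t_r` attached to the column `C`: `t_k` is the greatest unbarred letter
with `t_k < z_k`, `t_k < t_{k-1}` (if `k` is not the first index) and neither `t_k` nor its barred
version in `C`. -/
def IsSplitList (C : List (Letter n)) (J : List (Fin n)) : Prop :=
  J.length = (pairLetters C).length ∧
    ∀ (k : ℕ) (hI : k < (pairLetters C).length) (hJ : k < J.length),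
      IsGreatest {t : Fin n | t < (pairLetters C)[k] ∧ (0 < k → t < J[k - 1]) ∧
        unbarred t ∉ C ∧ barred t ∉ C} J[k]

/-- Admissible columns. -/
def IsAdmissible (C : List (Letter n)) : Prop := IsColumn C ∧ ∃ J, IsSplitList C J

/-- The column `rC`: each `z̄_k` of a pair is changed into `t̄_k`. -/
def rightCol (C : List (Letter n)) (J : List (Fin n)) : List (Letter n) :=
  ((C.toFinset \ ((pairLetters C).map barred).toFinset) ∪ (J.map barred).toFinset).sort (· ≤ ·)

/-- The column `lC`: each `z_k` of a pair is changed into `t_k`. -/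
def leftCol (C : List (Letter n)) (J : List (Fin n)) : List (Letter n) :=
  ((C.toFinset \ ((pairLetters C).map unbarred).toFinset) ∪
    (J.map unbarred).toFinset).sort (· ≤ ·)

/-- `C₁ ≤ C₂`: the height of `C₁` is at least that of `C₂`, and the rows of `C₁C₂` weakly
increase. -/
def ColLE (C₁ C₂ : List (Letter n)) : Prop :=
  C₂.length ≤ C₁.length ∧
    ∀ (k : ℕ) (h₁ : k < C₁.length) (h₂ : k < C₂.length), C₁[k] ≤ C₂[k]

/-- `rC₁ ≤ lC₂` for admissible columns. -/
def SplitLE (C₁ C₂ : List (Letter n)) : Prop :=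
  ∃ J₁ J₂, IsSplitList C₁ J₁ ∧ IsSplitList C₂ J₂ ∧ ColLE (rightCol C₁ J₁) (leftCol C₂ J₂)

/-- A filling, as the list of its columns from left to right. -/
abbrev Filling (n : ℕ) : Type := List (List (Letter n))

/-- The reading: columns from right to left, each from top to bottom. -/
def reading (T : Filling n) : List (Letter n) := T.reverse.flatten

/-- Column heights, from left to right, of the Young diagram with `lam j` columns of height `j + 1`
(`j : Fin n`), i.e. of the dominant weight `∑ j, lam j • Λ_{j+1}`. -/
def heights (lam : Fin n → ℕ) : List ℕ :=
  (List.finRange n).reverse.flatMap fun j => List.replicate (lam j) (j.val + 1)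

/-- Symplectic tableaux of shape `lam`. -/
def IsSymplecticTableau (lam : Fin n → ℕ) (T : Filling n) : Prop :=
  T.map List.length = heights lam ∧ (∀ C ∈ T, IsAdmissible C) ∧ T.IsChain SplitLE

/-- The highest weight column of height `p` with letters `1, …, p` (for `p ≤ n`). -/
def highestCol (n p : ℕ) : List (Letter n) := ((List.finRange n).map unbarred).take p

/-- The tableau `T_λ`, all of whose columns are of highest weight. -/
def highestTableau (lam : Fin n → ℕ) : Filling n := (heights lam).map (highestCol n)

/-- A letter `x` of `C` is movable if it has a predecessor `pred x` in the alphabet, and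
`pred x ∉ C`. -/
def IsMovable (C : List (Letter n)) (x : Letter n) : Prop :=
  x ∈ C ∧ ∃ p, IsGreatest {y | y < x} p ∧ p ∉ C

/-- One step of the algorithm, leading from `T` to `T₁` with output `i` and `r`.
`k` is the (0-based) index of the rightmost column `C` of `T` that is not of highest weight, `x` is
the lowest movable letter of `C`, `a` is the position of this `x` in the word `w(T)`, and `b` is the
position of the letter `y`: the last letter of `w(T)` in `{ī, i+1}` such that the factor `x ⋯ y`
contains no letter of `{(i+1)‾, i}`. -/
def IsStep (T : Filling n) (i : Fin n) (r : ℕ) (T₁ : Filling n) : Prop :=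
  ∃ (k : ℕ) (C : List (Letter n)) (x : Letter n) (a b : ℕ),
    (T[k]? = some C ∧ C ≠ highestCol n C.length ∧
      ∀ D ∈ T.drop (k + 1), D = highestCol n D.length) ∧
    IsLeast {z | IsMovable C z} x ∧
    eTilde i x ≠ none ∧
    a = (reading (T.drop (k + 1))).length + C.idxOf x ∧
    IsGreatest {c | a ≤ c ∧ (∃ y, (reading T)[c]? = some y ∧ IsMinus i y) ∧
      ∀ d, a ≤ d → d ≤ c → ∀ z, (reading T)[d]? = some z → ¬ IsPlus i z} b ∧
    r = (((reading T).take (b + 1)).drop a).countP (fun z => IsMinus i z) ∧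
    T₁.map List.length = T.map List.length ∧
    reading T₁ = (reading T).mapIdx fun c z => if a ≤ c ∧ c ≤ b then (eTilde i z).getD z else z

/-- `IsRun lam T out`: the algorithm started at `T` reaches `T_λ` after finitely many steps, and
`out = [(i₁, r₁), …, (i_s, r_s)]` is its output. -/
inductive IsRun (lam : Fin n → ℕ) : Filling n → List (Fin n × ℕ) → Prop
  | done : IsRun lam (highestTableau lam) []
  | next {T T₁ : Filling n} {i : Fin n} {r : ℕ} {out : List (Fin n × ℕ)} :
      T ≠ highestTableau lam → IsStep T i r T₁ → IsRun lam T₁ out → IsRun lam T ((i, r) :: out)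

end SymplecticTableaux

/-! Call letters of `IsMinus i` minus letters and those of `IsPlus i` plus letters. Because no minus
or plus letter precedes `x` in the reading of a symplectic tableau
(`IsSymplecticTableau.reading_prefix`), a step does not depend on where `x` and `y` sit: it lowers
every minus letter standing before the first plus letter of the whole word. This operation is
`activeLower`, and `mapIdx_eq_activeLower` identifies it with the step.

On columns, read from right to left, `activeLower` acts on each one up to and including the first
that contains a plus letter, and leaves the others alone. To stay a symplectic tableau it is enough
to follow `rC` and `lC` for one column. `IsSplitList.exists_activeLower` shows that lowering
commutes with `C ↦ rC`, and that it either fixes `lC` or commutes with `C ↦ lC` with no plus letter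
in `C` or `lC`. Since `rC` has no pair, `ColLE.activeLower` then preserves the inequality between
neighbours that are both lowered; at the boundary the right neighbour contains a plus letter, so its
`lC` does not change.

The greedy list `t₁ > ⋯ > t_r` is awkward to follow through a local change of the column. It is
replaced by the set of its elements, characterised by counting inequalities (`IsSplitSet`), and
these need rechecking only at the two letters concerned (`IsSplitSet.of_local`).

Each step lowers `x` and raises nothing, so the sum of the ranks of the reading drops. This gives
termination, and determinism of the step gives uniqueness of the output. -/

namespace SymplecticTableaux

open Letter

variable {n : ℕ}

/-! ### Letters and the lowering of one letter -/

namespace Letter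

theorem lt_iff_rank_lt {x y : Letter n} : x < y ↔ x.rank < y.rank := Iff.rfl

theorem le_iff_rank_le {x y : Letter n} : x ≤ y ↔ x.rank ≤ y.rank := Iff.rfl

@[simp] theorem rank_unbarred (j : Fin n) : (unbarred j).rank = j.val := rfl

@[simp] theorem rank_barred (j : Fin n) : (barred j).rank = 2 * n - 1 - j.val := rfl

instance (i : Fin n) : DecidablePred (IsPlus i) := fun x =>
  match x with
  | unbarred j => inferInstanceAs (Decidable (j = i))
  | barred j => inferInstanceAs (Decidable (j.val = i.val + 1))

@[simp] theorem isMinus_unbarred {i j : Fin n} : IsMinus i (unbarred j) ↔ j.val = i.val + 1 :=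
  Iff.rfl

@[simp] theorem isMinus_barred {i j : Fin n} : IsMinus i (barred j) ↔ j = i := Iff.rfl

@[simp] theorem isPlus_unbarred {i j : Fin n} : IsPlus i (unbarred j) ↔ j = i := Iff.rfl

@[simp] theorem isPlus_barred {i j : Fin n} : IsPlus i (barred j) ↔ j.val = i.val + 1 := Iff.rfl

/-- The operator `ẽᵢ`, extended by the identity to the letters it kills. -/
def lower (i : Fin n) (z : Letter n) : Letter n := (eTilde i z).getD z

theorem IsPlus.not_isMinus {i : Fin n} {z : Letter n} (h : IsPlus i z) : ¬ IsMinus i z := by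
  rcases z with j | j <;> simp only [isPlus_unbarred, isPlus_barred, isMinus_unbarred,
    isMinus_barred] at h ⊢
  · rw [h]; omega
  · rintro rfl; omega

theorem eTilde_ne_none_iff {i : Fin n} {z : Letter n} : eTilde i z ≠ none ↔ IsMinus i z := by
  rcases z with j | j
  · simp [eTilde]
  · simp only [eTilde, isMinus_barred]
    split_ifs <;> simp_all

theorem lower_of_not_isMinus {i : Fin n} {z : Letter n} (h : ¬ IsMinus i z) : lower i z = z := by
  have : eTilde i z = none := by
    by_contra h'; exact h (eTilde_ne_none_iff.1 h')
  simp [lower, this]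

theorem lower_unbarred_succ {i j : Fin n} (h : j.val = i.val + 1) :
    lower i (unbarred j) = unbarred i := by
  simp [lower, eTilde, h]

theorem lower_barred {i j : Fin n} (h : j.val = i.val + 1) :
    lower i (barred i) = barred j := by
  have h' : i.val + 1 < n := by omega
  simp only [lower, eTilde, if_true, dif_pos h', Option.getD_some]
  congr 1; ext; simp [h]

theorem lower_barred_last {i : Fin n} (h : ¬ i.val + 1 < n) :
    lower i (barred i) = unbarred i := by
  simp [lower, eTilde, h]

theorem isPlus_lower {i : Fin n} {z : Letter n} (h : IsMinus i z) : IsPlus i (lower i z) := by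
  rcases z with j | j
  · rw [lower_unbarred_succ h]; simp
  · obtain rfl := isMinus_barred.1 h
    by_cases hi : j.val + 1 < n
    · rw [lower_barred (j := ⟨j.val + 1, hi⟩) rfl]; simp
    · rw [lower_barred_last hi]; simp

theorem rank_lower_add_one {i : Fin n} {z : Letter n} (h : IsMinus i z) :
    (lower i z).rank + 1 = z.rank := by
  rcases z with j | j
  · rw [lower_unbarred_succ h]; simpa using h.symm
  · obtain rfl := isMinus_barred.1 h
    by_cases hi : j.val + 1 < n
    · rw [lower_barred (j := ⟨j.val + 1, hi⟩) rfl]; simp; omega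
    · rw [lower_barred_last hi]; simp; omega

theorem lower_le (i : Fin n) (z : Letter n) : lower i z ≤ z := by
  by_cases h : IsMinus i z
  · have := rank_lower_add_one h
    rw [le_iff_rank_le]; omega
  · rw [lower_of_not_isMinus h]

theorem le_lower {i : Fin n} {y z : Letter n} (h : IsMinus i z) (hy : y < z) : y ≤ lower i z := by
  have := rank_lower_add_one h
  rw [lt_iff_rank_lt] at hy
  rw [le_iff_rank_le]; omega

end Letter

/-! ### Lowering a word and a column -/

/-- Lower, in the word `w`, all letters of `{ī, i+1}` that precede the first letter of
`{(i+1)‾, i}`. -/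
def activeLower (i : Fin n) : List (Letter n) → List (Letter n)
  | [] => []
  | z :: w => if IsPlus i z then z :: w else lower i z :: activeLower i w

@[simp] theorem length_activeLower (i : Fin n) (w : List (Letter n)) :
    (activeLower i w).length = w.length := by
  induction w with
  | nil => rfl
  | cons z w ih => simp only [activeLower]; split_ifs <;> simp [ih]

-- Positional form of the recursion, needed for the comparison with the index-based description in
-- `IsStep`.
open scoped Classical in
theorem getElem?_activeLower (i : Fin n) (w : List (Letter n)) (c : ℕ) :
    (activeLower i w)[c]? =
      w[c]?.map fun z => if ∃ p ∈ w.take (c + 1), IsPlus i p then z else lower i z := by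
  induction w generalizing c with
  | nil => simp [activeLower]
  | cons z w ih =>
    by_cases h : IsPlus i z
    · simp [activeLower, h]
    · cases c with
      | zero => simp [activeLower, h]
      | succ c =>
        simp [activeLower, h, ih]
        congr! 3

theorem activeLower_append_of_exists {i : Fin n} {u : List (Letter n)} (h : ∃ p ∈ u, IsPlus i p)
    (v : List (Letter n)) : activeLower i (u ++ v) = activeLower i u ++ v := by
  induction u with
  | nil => simp at h
  | cons z u ih =>
    by_cases hz : IsPlus i z
    · simp [activeLower, hz]
    · simp only [List.cons_append, activeLower, hz, if_false]
      rw [ih (by simpa [hz] using h)]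

theorem activeLower_append_of_forall {i : Fin n} {u : List (Letter n)}
    (h : ∀ p ∈ u, ¬ IsPlus i p) (v : List (Letter n)) :
    activeLower i (u ++ v) = activeLower i u ++ activeLower i v := by
  induction u with
  | nil => simp [activeLower]
  | cons z u ih =>
    simp only [List.mem_cons, forall_eq_or_imp] at h
    simp only [List.cons_append, activeLower, h.1, if_false]
    rw [ih h.2]

/-- In a column, a letter is lowered by `activeLower` unless it lies below a letter of
`{(i+1)‾, i}`. -/
theorem activeLower_eq_map (i : Fin n) {C : List (Letter n)} (h : IsColumn C) :
    activeLower i C =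
      C.map fun z => if ∃ p ∈ C, IsPlus i p ∧ p < z then z else lower i z := by
  induction C with
  | nil => rfl
  | cons z w ih =>
    rw [IsColumn, List.pairwise_cons] at h
    by_cases hz : IsPlus i z
    · simp only [activeLower, hz, if_true, List.map_cons]
      congr 1
      · split_ifs
        · rfl
        · exact (lower_of_not_isMinus hz.not_isMinus).symm
      · symm
        rw [List.map_congr_left (g := id), List.map_id]
        intro y hy
        rw [if_pos ⟨z, by simp, hz, h.1 y hy⟩]; rfl
    · simp only [activeLower, hz, if_false, List.map_cons]
      congr 1
      · rw [if_neg]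
        rintro ⟨p, hp, hp1, hp2⟩
        rcases List.mem_cons.1 hp with rfl | hp
        · exact hz hp1
        · exact lt_asymm hp2 (h.1 p hp)
      · rw [ih h.2]
        simp [hz]

/-- Lowering moves a letter to its predecessor, so strictness could fail only if that predecessor is
already in the column. But the predecessor is a plus letter above it, which blocks the lowering. -/
theorem IsColumn.activeLower {C : List (Letter n)} (h : IsColumn C) (i : Fin n) :
    IsColumn (activeLower i C) := by
  rw [activeLower_eq_map i h, IsColumn, List.pairwise_map]
  refine List.Pairwise.imp_of_mem ?_ h
  intro z w hz hw hzw
  have hle : (if ∃ p ∈ C, IsPlus i p ∧ p < z then z else lower i z) ≤ z := by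
    split_ifs
    · exact le_rfl
    · exact lower_le i z
  refine lt_of_le_of_ne (hle.trans ?_) ?_
  · split_ifs with hp
    · exact hzw.le
    · by_cases hm : IsMinus i w
      · exact le_lower hm hzw
      · rw [lower_of_not_isMinus hm]; exact hzw.le
  · intro heq
    have key : z < if ∃ p ∈ C, IsPlus i p ∧ p < w then w else lower i w := by
      split_ifs with hp
      · exact hzw
      · by_cases hm : IsMinus i w
        · refine lt_of_le_of_ne (le_lower hm hzw) fun he => hp ⟨z, hz, ?_, hzw⟩
          rw [he]; exact isPlus_lower hm
        · rw [lower_of_not_isMinus hm]; exact hzw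
    rw [heq] at hle
    exact absurd key (not_lt.2 hle)

theorem mem_activeLower_of_not {i : Fin n} {C : List (Letter n)} (h : IsColumn C) {y : Letter n}
    (h₁ : ¬ IsPlus i y) (h₂ : ¬ IsMinus i y) : y ∈ activeLower i C ↔ y ∈ C := by
  rw [activeLower_eq_map i h, List.mem_map]
  constructor
  · rintro ⟨z, hz, hy⟩
    split_ifs at hy with hp
    · rwa [← hy]
    · by_cases hm : IsMinus i z
      · exact absurd (hy ▸ isPlus_lower hm) h₁
      · rw [lower_of_not_isMinus hm] at hy; rwa [← hy]
  · intro hy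
    exact ⟨y, hy, by rw [lower_of_not_isMinus h₂, ite_self]⟩

/-- A lowered minus letter becomes a plus letter, so the minus letters that remain are exactly the
blocked ones. -/
theorem mem_activeLower_of_isMinus {i : Fin n} {C : List (Letter n)} (h : IsColumn C)
    {y : Letter n} (hm : IsMinus i y) :
    y ∈ activeLower i C ↔ y ∈ C ∧ ∃ p ∈ C, IsPlus i p ∧ p < y := by
  rw [activeLower_eq_map i h, List.mem_map]
  constructor
  · rintro ⟨z, hz, hy⟩
    split_ifs at hy with hp
    · subst hy; exact ⟨hz, hp⟩
    · by_cases hm' : IsMinus i z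
      · exact absurd hm (hy ▸ isPlus_lower hm').not_isMinus
      · rw [lower_of_not_isMinus hm'] at hy; exact absurd (hy ▸ hm) hm'
  · rintro ⟨hy, hp⟩
    exact ⟨y, hy, by rw [if_pos hp]⟩

theorem mem_activeLower_of_isPlus {i : Fin n} {C : List (Letter n)} (h : IsColumn C)
    {y : Letter n} (hm : IsPlus i y) :
    y ∈ activeLower i C ↔
      y ∈ C ∨ ∃ z ∈ C, IsMinus i z ∧ lower i z = y ∧ ∀ p ∈ C, IsPlus i p → ¬ p < z := by
  rw [activeLower_eq_map i h, List.mem_map]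
  constructor
  · rintro ⟨z, hz, hy⟩
    split_ifs at hy with hp
    · subst hy; exact Or.inl hz
    · by_cases hm' : IsMinus i z
      · exact Or.inr ⟨z, hz, hm', hy, fun p h1 h2 h3 => hp ⟨p, h1, h2, h3⟩⟩
      · rw [lower_of_not_isMinus hm'] at hy; subst hy; exact Or.inl hz
  · rintro (hy | ⟨z, hz, hz1, hz2, hz3⟩)
    · exact ⟨y, hy, by rw [lower_of_not_isMinus hm.not_isMinus, ite_self]⟩
    · refine ⟨z, hz, ?_⟩
      rw [if_neg, hz2]
      rintro ⟨p, h1, h2, h3⟩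
      exact hz3 p h1 h2 h3

section Membership

variable {i j : Fin n} {C : List (Letter n)}

theorem unbarred_mem_activeLower_of_ne (h : IsColumn C) {k : Fin n} (hi : k ≠ i)
    (hj : k.val ≠ i.val + 1) : unbarred k ∈ activeLower i C ↔ unbarred k ∈ C :=
  mem_activeLower_of_not h (by simpa using hi) (by simpa using hj)

theorem barred_mem_activeLower_of_ne (h : IsColumn C) {k : Fin n} (hi : k ≠ i)
    (hj : k.val ≠ i.val + 1) : barred k ∈ activeLower i C ↔ barred k ∈ C :=
  mem_activeLower_of_not h (by simpa using hj) (by simpa using hi)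

theorem isPlus_iff_of_succ (hij : j.val = i.val + 1) {p : Letter n} :
    IsPlus i p ↔ p = unbarred i ∨ p = barred j := by
  rcases p with k | k
  · simp
  · simp [Fin.ext_iff, hij]

theorem isMinus_iff_of_succ (hij : j.val = i.val + 1) {p : Letter n} :
    IsMinus i p ↔ p = unbarred j ∨ p = barred i := by
  rcases p with k | k
  · simp [Fin.ext_iff, hij]
  · simp

theorem isPlus_iff_of_last (hi : ¬ i.val + 1 < n) {p : Letter n} :
    IsPlus i p ↔ p = unbarred i := by
  rcases p with k | k
  · simp
  · simp; omega

theorem isMinus_iff_of_last (hi : ¬ i.val + 1 < n) {p : Letter n} :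
    IsMinus i p ↔ p = barred i := by
  rcases p with k | k
  · simp; omega
  · simp

theorem unbarred_mem_activeLower (h : IsColumn C) (hij : j.val = i.val + 1) :
    unbarred i ∈ activeLower i C ↔ unbarred i ∈ C ∨ unbarred j ∈ C := by
  rw [mem_activeLower_of_isPlus h (by simp)]
  simp only [isMinus_iff_of_succ hij, isPlus_iff_of_succ hij]
  constructor
  · rintro (h | ⟨z, hz, rfl | rfl, hz2, hz3⟩)
    · exact Or.inl h
    · exact Or.inr hz
    · rw [lower_barred hij] at hz2; cases hz2
  · rintro (h | h)
    · exact Or.inl h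
    · by_cases hi : unbarred i ∈ C
      · exact Or.inl hi
      · refine Or.inr ⟨_, h, Or.inl rfl, lower_unbarred_succ hij, ?_⟩
        rintro p hp (rfl | rfl)
        · exact absurd hp hi
        · simp [lt_iff_rank_lt]; omega

theorem unbarred_succ_mem_activeLower (h : IsColumn C) (hij : j.val = i.val + 1) :
    unbarred j ∈ activeLower i C ↔ unbarred j ∈ C ∧ unbarred i ∈ C := by
  rw [mem_activeLower_of_isMinus h (by simpa using hij)]
  simp only [isPlus_iff_of_succ hij]
  refine and_congr_right fun _ => ⟨?_, fun hi => ⟨_, hi, Or.inl rfl, ?_⟩⟩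
  · rintro ⟨p, hp, rfl | rfl, hlt⟩
    · exact hp
    · simp [lt_iff_rank_lt] at hlt; omega
  · simp [lt_iff_rank_lt]; omega

theorem barred_succ_mem_activeLower (h : IsColumn C) (hij : j.val = i.val + 1) :
    barred j ∈ activeLower i C ↔ barred j ∈ C ∨ (barred i ∈ C ∧ unbarred i ∉ C) := by
  rw [mem_activeLower_of_isPlus h (by simpa using hij)]
  simp only [isMinus_iff_of_succ hij, isPlus_iff_of_succ hij]
  constructor
  · rintro (h | ⟨z, hz, rfl | rfl, hz2, hz3⟩)
    · exact Or.inl h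
    · rw [lower_unbarred_succ hij] at hz2; cases hz2
    · refine Or.inr ⟨hz, fun hu => hz3 _ hu (Or.inl rfl) ?_⟩
      simp [lt_iff_rank_lt]; omega
  · rintro (h | h)
    · exact Or.inl h
    · by_cases hi : barred j ∈ C
      · exact Or.inl hi
      · refine Or.inr ⟨_, h.1, Or.inr rfl, lower_barred hij, ?_⟩
        rintro p hp (rfl | rfl)
        · exact absurd hp h.2
        · exact absurd hp hi

theorem barred_mem_activeLower (h : IsColumn C) (hij : j.val = i.val + 1) :
    barred i ∈ activeLower i C ↔ barred i ∈ C ∧ (unbarred i ∈ C ∨ barred j ∈ C) := by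
  rw [mem_activeLower_of_isMinus h (by simp)]
  simp only [isPlus_iff_of_succ hij]
  refine and_congr_right fun _ => ⟨?_, ?_⟩
  · rintro ⟨p, hp, rfl | rfl, hlt⟩
    · exact Or.inl hp
    · exact Or.inr hp
  · rintro (h | h)
    · exact ⟨_, h, Or.inl rfl, by simp [lt_iff_rank_lt]; omega⟩
    · exact ⟨_, h, Or.inr rfl, by simp [lt_iff_rank_lt]; omega⟩

theorem unbarred_mem_activeLower_last (h : IsColumn C) (hi : ¬ i.val + 1 < n) :
    unbarred i ∈ activeLower i C ↔ unbarred i ∈ C ∨ barred i ∈ C := by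
  rw [mem_activeLower_of_isPlus h (by simp)]
  simp only [isMinus_iff_of_last hi, isPlus_iff_of_last hi]
  constructor
  · rintro (h | ⟨z, hz, rfl, hz2, hz3⟩)
    · exact Or.inl h
    · exact Or.inr hz
  · rintro (h | h)
    · exact Or.inl h
    · by_cases hu : unbarred i ∈ C
      · exact Or.inl hu
      · refine Or.inr ⟨_, h, rfl, lower_barred_last hi, ?_⟩
        rintro p hp rfl
        exact absurd hp hu

theorem barred_mem_activeLower_last (h : IsColumn C) (hi : ¬ i.val + 1 < n) :
    barred i ∈ activeLower i C ↔ barred i ∈ C ∧ unbarred i ∈ C := by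
  rw [mem_activeLower_of_isMinus h (by simp)]
  simp only [isPlus_iff_of_last hi]
  refine and_congr_right fun _ => ⟨?_, fun hu => ⟨_, hu, rfl, ?_⟩⟩
  · rintro ⟨p, hp, rfl, hlt⟩
    exact hp
  · simp [lt_iff_rank_lt]; omega

end Membership

theorem isColumn_eq_of_mem_iff {A B : List (Letter n)} (hA : IsColumn A) (hB : IsColumn B)
    (h : ∀ x, x ∈ A ↔ x ∈ B) : A = B :=
  List.Perm.eq_of_pairwise (le := (· < ·)) (fun _ _ _ _ h₁ h₂ => absurd h₁ (lt_asymm h₂)) hA hB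
    ((List.perm_ext_iff_of_nodup (hA.imp ne_of_lt) (hB.imp ne_of_lt)).2 h)

/-- Lowering is monotone for columns without pairs `(i, ī)` when the right column has no letter
of `{(i+1)‾, i}`. -/
theorem ColLE.activeLower {E F : List (Letter n)} (h : ColLE E F) (hE : IsColumn E)
    (hF : IsColumn F) (i : Fin n) (hFp : ∀ p ∈ F, ¬ IsPlus i p)
    (hEp : unbarred i ∈ E → barred i ∉ E) :
    ColLE (activeLower i E) (activeLower i F) := by
  refine ⟨by simpa using h.1, fun k h₁ h₂ => ?_⟩
  simp only [length_activeLower] at h₁ h₂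
  have hle := h.2 k h₁ h₂
  simp only [activeLower_eq_map i hE, activeLower_eq_map i hF, List.getElem_map]
  have hF' : ¬ ∃ p ∈ F, IsPlus i p ∧ p < F[k] := fun ⟨p, hp, hp', _⟩ => hFp p hp hp'
  rw [if_neg hF']
  have hEle : (if ∃ p ∈ E, IsPlus i p ∧ p < E[k] then E[k] else lower i E[k]) ≤ E[k] := by
    split_ifs
    · exact le_rfl
    · exact lower_le _ _
  by_cases hm : IsMinus i F[k]
  swap
  · rw [lower_of_not_isMinus hm]; exact hEle.trans hle
  rcases hle.lt_or_eq with hlt | heq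
  · exact hEle.trans (le_lower hm hlt)
  -- Only equal entries that are minus letters are delicate: the left one must not be blocked while
  -- the right one is lowered.
  rw [heq, if_neg]
  rintro ⟨p, hp, hpp, hlt⟩
  obtain ⟨m, hm1, rfl⟩ := List.getElem_of_mem hp
  have hmono := fun {a b : ℕ} (ha : a < F.length) (hb : b < F.length) (hab : a < b) =>
    List.pairwise_iff_getElem.1 hF a b ha hb hab
  have hEmono := fun {a b : ℕ} (ha : a < E.length) (hb : b < E.length) (hab : a < b) =>
    List.pairwise_iff_getElem.1 hE a b ha hb hab
  have hmk : m < k := by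
    rw [← heq] at hlt
    by_contra hcon
    rcases (not_lt.1 hcon).lt_or_eq with hc | rfl
    · exact lt_asymm hlt (hEmono h₁ hm1 hc)
    · exact lt_irrefl _ hlt
  -- the letter of `{(i+1)‾, i}` above `E[k]` must be the predecessor of `E[k]`
  have hpl : E[m] = lower i F[k] := by
    have hin : F[k] ∈ E := heq ▸ List.getElem_mem h₁
    by_cases hi : i.val + 1 < n
    · rw [isPlus_iff_of_succ (j := ⟨i.val + 1, hi⟩) rfl] at hpp
      rw [isMinus_iff_of_succ (j := ⟨i.val + 1, hi⟩) rfl] at hm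
      rcases hm with hm | hm <;> rw [hm] at hlt hin ⊢ <;> rcases hpp with hpp | hpp <;>
        rw [hpp] at hlt ⊢
      · exact (lower_unbarred_succ rfl).symm
      · simp [lt_iff_rank_lt] at hlt; omega
      · exact absurd hin (hEp (hpp ▸ hp))
      · exact (lower_barred rfl).symm
    · rw [isPlus_iff_of_last hi] at hpp
      rw [isMinus_iff_of_last hi] at hm
      rw [hpp, hm, lower_barred_last hi]
  have hm2 : m < F.length := hmk.trans h₂
  have h1 := h.2 m hm1 hm2
  -- Row `m` squeezes `F[m]` between `E[m]` and the predecessor of `F[k]`, which coincide; hence `F`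
  -- would contain a plus letter.
  have h2 := le_lower hm (hmono hm2 h₂ hmk)
  rw [hpl] at h1
  have h3 : F[m] = lower i F[k] := le_antisymm h2 h1
  exact hFp _ (List.getElem_mem hm2) (h3 ▸ isPlus_lower hm)

theorem ColLE.activeLower_left {E F : List (Letter n)} (h : ColLE E F) (hE : IsColumn E)
    (i : Fin n) : ColLE (SymplecticTableaux.activeLower i E) F := by
  refine ⟨by simpa using h.1, fun k h₁ h₂ => ?_⟩
  simp only [length_activeLower] at h₁
  simp only [activeLower_eq_map i hE, List.getElem_map]
  refine le_trans ?_ (h.2 k h₁ h₂)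
  split_ifs
  · exact le_rfl
  · exact lower_le _ _

end SymplecticTableaux

/-! ### Split lists as sets defined by counting -/

namespace SymplecticTableaux

open Letter Finset

variable {n : ℕ}

/-- The number of elements of `S` that are at least `m`. -/
def countGE (S : Finset (Fin n)) (m : ℕ) : ℕ := #{s ∈ S | m ≤ s.val}

theorem countGE_congr {S S' : Finset (Fin n)} {m : ℕ}
    (h : ∀ s : Fin n, m ≤ s.val → (s ∈ S ↔ s ∈ S')) : countGE S m = countGE S' m := by
  unfold countGE
  congr 1
  ext s
  simp only [mem_filter]
  constructor <;> rintro ⟨h1, h2⟩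
  · exact ⟨(h s h2).1 h1, h2⟩
  · exact ⟨(h s h2).2 h1, h2⟩

theorem countGE_zero (S : Finset (Fin n)) : countGE S 0 = #S := by simp [countGE]

theorem countGE_eq_add (S : Finset (Fin n)) {m j : ℕ} (h : m ≤ j) :
    countGE S m = #{s ∈ S | m ≤ s.val ∧ s.val < j} + countGE S j := by
  unfold countGE
  rw [← card_union_of_disjoint]
  · congr 1
    ext s
    simp only [mem_filter, mem_union]
    grind
  · rw [disjoint_left]
    intro s
    simp only [mem_filter]
    grind

theorem countGE_succ (S : Finset (Fin n)) (j : Fin n) :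
    countGE S j.val = countGE S (j.val + 1) + if j ∈ S then 1 else 0 := by
  rw [countGE_eq_add S (Nat.le_succ j.val), add_comm]
  congr 1
  have : ∀ s : Fin n, (j.val ≤ s.val ∧ s.val < j.val + 1) ↔ s = j := by
    intro s; rw [Fin.ext_iff]; omega
  simp only [Nat.succ_eq_add_one, this]
  rw [filter_eq']
  split_ifs <;> simp

theorem countGE_add {S S' : Finset (Fin n)} {m j : ℕ} (h : m ≤ j)
    (hS : ∀ s : Fin n, s.val < j → (s ∈ S ↔ s ∈ S')) :
    countGE S m + countGE S' j = countGE S' m + countGE S j := by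
  rw [countGE_eq_add S h, countGE_eq_add S' h]
  have : ({s ∈ S | m ≤ s.val ∧ s.val < j} : Finset (Fin n)) =
      {s ∈ S' | m ≤ s.val ∧ s.val < j} := by
    ext s
    simp only [mem_filter]
    grind
  rw [this]; omega

/-- `T` is the set `{t₁, …, t_r}` attached to a column with pairs `Z = {z₁, …, z_r}` and set `F` of
letters absent together with their barred versions. -/
structure IsSplitSet (Z F T : Finset (Fin n)) : Prop where
  subset : T ⊆ F
  count_le : ∀ m, countGE T m ≤ countGE Z m
  count_ge : ∀ f ∈ F, f ∉ T → countGE Z f.val ≤ countGE T f.val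
  card_eq : #T = #Z

/-- A split set stays one under a change at two consecutive letters, provided that the defining
conditions hold at these letters. -/
theorem IsSplitSet.of_local {Z F T Z' F' T' : Finset (Fin n)} (h : IsSplitSet Z F T) {i j : Fin n}
    (hij : j.val = i.val + 1)
    (hZ : ∀ s, s ≠ i → s ≠ j → (s ∈ Z ↔ s ∈ Z')) (hF : ∀ s, s ≠ i → s ≠ j → (s ∈ F ↔ s ∈ F'))
    (hT : ∀ s, s ≠ i → s ≠ j → (s ∈ T ↔ s ∈ T'))
    (hi : i ∈ T' → i ∈ F') (hj : j ∈ T' → j ∈ F')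
    (hle : countGE T' j.val ≤ countGE Z' j.val)
    (heq : countGE T' i.val + countGE Z i.val = countGE Z' i.val + countGE T i.val)
    (hgi : i ∈ F' → i ∉ T' → countGE Z' i.val ≤ countGE T' i.val)
    (hgj : j ∈ F' → j ∉ T' → countGE Z' j.val ≤ countGE T' j.val) :
    IsSplitSet Z' F' T' := by
  -- At or below `i`, the counts of `T` and of `Z` change by the same amount, so their comparison is
  -- unaffected; above `j` neither count changes.
  have low : ∀ m ≤ i.val, countGE T' m + countGE Z m = countGE Z' m + countGE T m := by
    intro m hm
    have h1 := countGE_add (S := T) (S' := T') hm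
      (fun s hs => hT s (by rintro rfl; omega) (by rintro rfl; omega))
    have h2 := countGE_add (S := Z) (S' := Z') hm
      (fun s hs => hZ s (by rintro rfl; omega) (by rintro rfl; omega))
    omega
  have high : ∀ m, j.val < m → countGE T m = countGE T' m ∧ countGE Z m = countGE Z' m :=
    fun m hm => ⟨countGE_congr fun s hs => hT s (by rintro rfl; omega) (by rintro rfl; omega),
      countGE_congr fun s hs => hZ s (by rintro rfl; omega) (by rintro rfl; omega)⟩
  constructor
  · intro s hs
    by_cases h1 : s = i
    · subst h1; exact hi hs
    by_cases h2 : s = j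
    · subst h2; exact hj hs
    exact (hF s h1 h2).1 (h.subset ((hT s h1 h2).2 hs))
  · intro m
    have := h.count_le m
    rcases lt_trichotomy m j.val with hm | rfl | hm
    · have := low m (by omega); omega
    · exact hle
    · have := high m hm; omega
  · intro f hf hf'
    by_cases h1 : f = i
    · subst h1; exact hgi hf hf'
    by_cases h2 : f = j
    · subst h2; exact hgj hf hf'
    have := h.count_ge f ((hF f h1 h2).2 hf) (fun hh => hf' ((hT f h1 h2).1 hh))
    have h1' : f.val ≠ i.val := fun hh => h1 (Fin.ext hh)
    have h2' : f.val ≠ j.val := fun hh => h2 (Fin.ext hh)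
    rcases lt_trichotomy f.val j.val with hm | hm | hm
    · have := low f.val (by omega); omega
    · exact absurd hm h2'
    · have := high f.val hm; omega
  · have := low 0 (Nat.zero_le _)
    simp only [countGE_zero] at this
    have := h.card_eq
    omega

/-- The letters `z` with `z` and `z̄` in the column. -/
def pairSet (C : List (Letter n)) : Finset (Fin n) := {z | unbarred z ∈ C ∧ barred z ∈ C}

/-- The letters `t` with neither `t` nor its barred version in the column. -/
def freeSet (C : List (Letter n)) : Finset (Fin n) := {t | unbarred t ∉ C ∧ barred t ∉ C}

@[simp] theorem mem_pairSet {C : List (Letter n)} {z : Fin n} :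
    z ∈ pairSet C ↔ unbarred z ∈ C ∧ barred z ∈ C := by simp [pairSet]

@[simp] theorem mem_freeSet {C : List (Letter n)} {z : Fin n} :
    z ∈ freeSet C ↔ unbarred z ∉ C ∧ barred z ∉ C := by simp [freeSet]

@[simp] theorem mem_pairLetters {C : List (Letter n)} {z : Fin n} :
    z ∈ pairLetters C ↔ unbarred z ∈ C ∧ barred z ∈ C := by simp [pairLetters]

theorem pairLetters_toFinset (C : List (Letter n)) : (pairLetters C).toFinset = pairSet C := by
  ext z; simp

theorem pairLetters_pairwise (C : List (Letter n)) : (pairLetters C).Pairwise (· > ·) := by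
  apply List.Pairwise.filter
  rw [List.pairwise_reverse]
  exact List.pairwise_lt_finRange n

/-- In a strictly decreasing list, the elements that are at least `m` form an initial segment. -/
theorem lt_countGE_iff {L : List (Fin n)} (hL : L.Pairwise (· > ·)) {k : ℕ} (hk : k < L.length)
    (m : ℕ) : k < countGE L.toFinset m ↔ m ≤ (L[k]).val := by
  induction L generalizing k with
  | nil => simp at hk
  | cons a L ih =>
    rw [List.pairwise_cons] at hL
    have ha : a ∉ L := fun h => lt_irrefl _ (hL.1 a h)
    have hc : countGE (a :: L).toFinset m = (if m ≤ a.val then 1 else 0) + countGE L.toFinset m := by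
      unfold countGE
      rw [List.toFinset_cons, filter_insert]
      split_ifs with h
      · rw [card_insert_of_notMem (by simp [ha]), add_comm]
      · rw [zero_add]
    rw [hc]
    by_cases hm : m ≤ a.val
    · cases k with
      | zero => simp [hm]
      | succ k =>
        rw [List.getElem_cons_succ, ← ih hL.2 (by simpa using hk), if_pos hm]
        omega
    · have h0 : countGE L.toFinset m = 0 := by
        unfold countGE
        rw [card_eq_zero, filter_eq_empty_iff]
        intro s hs
        have := hL.1 s (by simpa using hs)
        simp only [gt_iff_lt, Fin.lt_def] at this
        omega
      rw [h0, if_neg hm]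
      cases k with
      | zero => simpa using hm
      | succ k =>
        have := hL.1 (L[k]'(by simpa using hk)) (List.getElem_mem _)
        simp only [gt_iff_lt, Fin.lt_def] at this
        simp only [List.getElem_cons_succ]
        omega

theorem IsSplitList.pairwise {C : List (Letter n)} {J : List (Fin n)} (h : IsSplitList C J) :
    J.Pairwise (· > ·) := by
  rw [← List.isChain_iff_pairwise, List.isChain_iff_getElem]
  intro k hk
  exact (h.2 (k + 1) (h.1 ▸ hk) hk).1.2.1 (Nat.succ_pos k)

theorem IsSplitList.unique {C : List (Letter n)} {J J' : List (Fin n)} (h : IsSplitList C J)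
    (h' : IsSplitList C J') : J = J' := by
  refine List.ext_getElem (h.1.trans h'.1.symm) fun k => ?_
  induction k with
  | zero =>
    intro h1 h2
    have e1 := h.2 0 (h.1 ▸ h1) h1
    have e2 := h'.2 0 (h.1 ▸ h1) h2
    simp only [lt_irrefl, false_imp_iff, true_and] at e1 e2
    exact e1.unique e2
  | succ k ih =>
    intro h1 h2
    have e1 := h.2 (k + 1) (h.1 ▸ h1) h1
    have e2 := h'.2 (k + 1) (h.1 ▸ h1) h2
    simp only [Nat.add_sub_cancel] at e1 e2
    rw [ih (by omega) (by omega)] at e1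
    exact e1.unique e2

/-- The condition `t_k < z_k` for all `k` amounts to domination of counts from above. Maximality
says that a free letter passed over was not available: all `z` at or above it were already served.
-/
theorem IsSplitList.isSplitSet {C : List (Letter n)} {J : List (Fin n)} (h : IsSplitList C J) :
    IsSplitSet (pairSet C) (freeSet C) J.toFinset := by
  have hJ := h.pairwise
  have hZ := pairLetters_pairwise C
  have cJ : #J.toFinset = J.length := List.toFinset_card_of_nodup (hJ.imp ne_of_gt)
  have cZ : #(pairLetters C).toFinset = (pairLetters C).length :=
    List.toFinset_card_of_nodup (hZ.imp ne_of_gt)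
  rw [← pairLetters_toFinset]
  constructor
  · intro t ht
    rw [List.mem_toFinset] at ht
    obtain ⟨k, hk, rfl⟩ := List.getElem_of_mem ht
    exact mem_freeSet.2 (h.2 k (h.1 ▸ hk) hk).1.2.2
  · intro m
    by_contra hcon
    rw [not_le] at hcon
    -- If the count of `J` exceeds that of the pairs, the next index `k` has `t_k ≥ m > z_k`.
    set k := countGE (pairLetters C).toFinset m with hkdef
    have hk : k < J.length := lt_of_lt_of_le hcon (cJ ▸ card_filter_le _ _)
    have h1 := (lt_countGE_iff hJ hk m).1 hcon
    have h2 := (h.2 k (h.1 ▸ hk) hk).1.1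
    rw [Fin.lt_def] at h2
    have h3 := (lt_countGE_iff hZ (h.1 ▸ hk) m).2 (by omega)
    omega
  · intro f hf hfJ
    by_contra hcon
    rw [not_le] at hcon
    -- Here `k` is the first index with `t_k` below `f`, while `z_k` is still at least `f`; so `f`
    -- was a larger candidate for `t_k`.
    set k := countGE J.toFinset f.val with hkdef
    have hk : k < (pairLetters C).length := lt_of_lt_of_le hcon (cZ ▸ card_filter_le _ _)
    have hk' : k < J.length := h.1 ▸ hk
    have hfree := mem_freeSet.1 hf
    have h1 := (lt_countGE_iff hZ hk f.val).1 hcon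
    have h2 : f ≤ J[k] := by
      apply (h.2 k hk hk').2
      refine ⟨lt_of_le_of_ne h1 ?_, fun hk0 => ?_, hfree⟩
      · intro he
        have : f ∈ pairLetters C := by rw [he]; exact List.getElem_mem hk
        exact hfree.1 (mem_pairLetters.1 this).1
      · have h3 := (lt_countGE_iff hJ (show k - 1 < J.length by omega) f.val).1 (by omega)
        refine lt_of_le_of_ne h3 fun he => hfJ ?_
        rw [List.mem_toFinset, he]
        exact List.getElem_mem _
    have := (lt_countGE_iff hJ hk' f.val).2 h2
    omega
  · rw [cJ, cZ, h.1]

/-- Sorting the set decreasingly recovers the greedy list: the counting inequalities give `t_k ≤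
z_k`, made strict because `t_k` is free, and rule out any larger candidate. -/
theorem IsSplitSet.exists_isSplitList {C : List (Letter n)} {T : Finset (Fin n)}
    (h : IsSplitSet (pairSet C) (freeSet C) T) : ∃ J, IsSplitList C J ∧ J.toFinset = T := by
  have hZ := pairLetters_pairwise C
  have cZ : #(pairLetters C).toFinset = (pairLetters C).length :=
    List.toFinset_card_of_nodup (hZ.imp ne_of_gt)
  obtain ⟨J, hJ, rfl⟩ : ∃ J : List (Fin n), J.Pairwise (· > ·) ∧ J.toFinset = T := by
    refine ⟨(T.sort (· ≤ ·)).reverse, ?_, by simp⟩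
    rw [List.pairwise_reverse]
    exact T.sortedLT_sort.pairwise
  have cJ : #J.toFinset = J.length := List.toFinset_card_of_nodup (hJ.imp ne_of_gt)
  rw [← pairLetters_toFinset] at h
  have hlen : J.length = (pairLetters C).length := by rw [← cJ, ← cZ, h.card_eq]
  refine ⟨J, ⟨hlen, fun k hI hk => ⟨⟨?_, ?_, ?_⟩, ?_⟩⟩, rfl⟩
  · have h1 := (lt_countGE_iff hJ hk (J[k]).val).2 le_rfl
    have h2 := (lt_countGE_iff hZ hI (J[k]).val).1 (h1.trans_le (h.count_le _))
    refine lt_of_le_of_ne h2 fun he => ?_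
    have h3 := mem_freeSet.1 (h.subset (List.mem_toFinset.2 (List.getElem_mem hk)))
    have h4 : J[k] ∈ pairLetters C := by rw [he]; exact List.getElem_mem hI
    exact h3.1 (mem_pairLetters.1 h4).1
  · intro hk0
    exact List.pairwise_iff_getElem.1 hJ (k - 1) k (by omega) hk (by omega)
  · exact mem_freeSet.1 (h.subset (List.mem_toFinset.2 (List.getElem_mem hk)))
  · rintro u ⟨hu1, hu2, hu3⟩
    by_contra hcon
    rw [not_le] at hcon
    have h1 := (lt_countGE_iff hZ hI u.val).2 (le_of_lt hu1)
    have h2 : ¬ k < countGE J.toFinset u.val := by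
      rw [lt_countGE_iff hJ hk]
      rw [Fin.lt_def] at hcon; omega
    have h3 : u ∉ J.toFinset := by
      intro hu
      rw [List.mem_toFinset] at hu
      obtain ⟨m, hm, rfl⟩ := List.getElem_of_mem hu
      have hmono := List.pairwise_iff_getElem.1 hJ
      rcases lt_trichotomy m k with hmk | rfl | hmk
      · have h5 := hu2 (by omega)
        rcases (show m ≤ k - 1 by omega).lt_or_eq with h6 | h6
        · exact lt_asymm h5 (hmono m (k - 1) hm (by omega) h6)
        · simp [h6] at h5
      · exact lt_irrefl _ hcon
      · exact lt_asymm hcon (hmono k m hk hm hmk)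
    have h4 := h.count_ge u (mem_freeSet.2 hu3) h3
    omega

/-! ### Effect of lowering on `rC` and `lC` -/

/-- The set of letters of `rC`. -/
def rightSet (C : List (Letter n)) (T : Finset (Fin n)) : Finset (Letter n) :=
  (C.toFinset \ (pairSet C).image barred) ∪ T.image barred

/-- The set of letters of `lC`. -/
def leftSet (C : List (Letter n)) (T : Finset (Fin n)) : Finset (Letter n) :=
  (C.toFinset \ (pairSet C).image unbarred) ∪ T.image unbarred

theorem rightCol_eq (C : List (Letter n)) (J : List (Fin n)) :
    rightCol C J = (rightSet C J.toFinset).sort (· ≤ ·) := by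
  unfold rightCol rightSet
  congr 1
  ext x
  simp

theorem leftCol_eq (C : List (Letter n)) (J : List (Fin n)) :
    leftCol C J = (leftSet C J.toFinset).sort (· ≤ ·) := by
  unfold leftCol leftSet
  congr 1
  ext x
  simp

section

variable {C : List (Letter n)} {T : Finset (Fin n)} {k : Fin n}

@[simp] theorem unbarred_mem_rightSet : unbarred k ∈ rightSet C T ↔ unbarred k ∈ C := by
  simp [rightSet]

@[simp] theorem barred_mem_rightSet :
    barred k ∈ rightSet C T ↔ (barred k ∈ C ∧ unbarred k ∉ C) ∨ k ∈ T := by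
  simp [rightSet]; tauto

@[simp] theorem barred_mem_leftSet : barred k ∈ leftSet C T ↔ barred k ∈ C := by
  simp [leftSet]

@[simp] theorem unbarred_mem_leftSet :
    unbarred k ∈ leftSet C T ↔ (unbarred k ∈ C ∧ barred k ∉ C) ∨ k ∈ T := by
  simp [leftSet]; tauto

end

theorem isColumn_sort (S : Finset (Letter n)) : IsColumn (S.sort (· ≤ ·)) :=
  S.sortedLT_sort.pairwise

set_option maxHeartbeats 2000000 in
/-- The split set of a lowered column, for `i < n`. -/
theorem exists_isSplitSet_activeLower {C : List (Letter n)} (hC : IsColumn C)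
    {T : Finset (Fin n)} (h : IsSplitSet (pairSet C) (freeSet C) T) {i j : Fin n}
    (hij : j.val = i.val + 1) :
    ∃ T', IsSplitSet (pairSet (activeLower i C)) (freeSet (activeLower i C)) T' ∧
      (∀ s, s ≠ i → s ≠ j → (s ∈ T ↔ s ∈ T')) ∧
      (((unbarred i ∈ C ∨ (unbarred j ∉ C ∧ barred j ∈ C) ∨ (unbarred j ∈ C ∧ barred i ∈ C)) ∧
        T' = T) ∨
      (unbarred i ∉ C ∧ unbarred j ∉ C ∧ barred j ∉ C ∧ barred i ∉ C ∧ T' = T) ∨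
      (unbarred i ∉ C ∧ unbarred j ∈ C ∧ barred j ∉ C ∧ barred i ∉ C ∧
        i ∉ T' ∧ (j ∈ T' ↔ i ∈ T)) ∨
      (unbarred i ∉ C ∧ unbarred j ∉ C ∧ barred j ∉ C ∧ barred i ∈ C ∧
        (i ∈ T' ↔ j ∈ T) ∧ j ∉ T') ∨
      (unbarred i ∉ C ∧ unbarred j ∈ C ∧ barred j ∈ C ∧ barred i ∉ C ∧
        i ∈ T ∧ i ∉ T' ∧ j ∉ T')) ∧
      (unbarred i ∉ C → unbarred j ∉ C → barred j ∉ C → barred i ∉ C → i ∈ T → j ∈ T) := by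
  have hne : i ≠ j := by rintro rfl; omega
  have m1 := unbarred_mem_activeLower hC hij
  have m2 := unbarred_succ_mem_activeLower hC hij
  have m3 := barred_succ_mem_activeLower hC hij
  have m4 := barred_mem_activeLower hC hij
  have m5 : ∀ s, s ≠ i → s ≠ j → (unbarred s ∈ activeLower i C ↔ unbarred s ∈ C) :=
    fun s h1 h2 => unbarred_mem_activeLower_of_ne hC h1 (fun h => h2 (Fin.ext (by omega)))
  have m6 : ∀ s, s ≠ i → s ≠ j → (barred s ∈ activeLower i C ↔ barred s ∈ C) :=
    fun s h1 h2 => barred_mem_activeLower_of_ne hC h1 (fun h => h2 (Fin.ext (by omega)))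
  set C' := activeLower i C with hC'
  have hZ : ∀ s, s ≠ i → s ≠ j → (s ∈ pairSet C ↔ s ∈ pairSet C') := by
    intro s h1 h2; simp only [mem_pairSet, m5 s h1 h2, m6 s h1 h2]
  have hF : ∀ s, s ≠ i → s ≠ j → (s ∈ freeSet C ↔ s ∈ freeSet C') := by
    intro s h1 h2; simp only [mem_freeSet, m5 s h1 h2, m6 s h1 h2]
  have cZ := countGE_congr (S := pairSet C) (S' := pairSet C') (m := j.val + 1)
    fun s hs => hZ s (by rintro rfl; omega) (by rintro rfl; omega)
  have eZj := countGE_succ (pairSet C) j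
  have eZi := countGE_succ (pairSet C) i
  have eZj' := countGE_succ (pairSet C') j
  have eZi' := countGE_succ (pairSet C') i
  have eTj := countGE_succ T j
  have eTi := countGE_succ T i
  have hlej := h.count_le j.val
  have hlei := h.count_le i.val
  have hlek := h.count_le (j.val + 1)
  have hgi := h.count_ge i
  have hgj := h.count_ge j
  have hsi : i ∈ T → i ∈ freeSet C := fun hh => h.subset hh
  have hsj : j ∈ T → j ∈ freeSet C := fun hh => h.subset hh
  rw [← hij] at eZi eZi' eTi
  -- reduction to the choice of the two memberships `i ∈ T'`, `j ∈ T'`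
  have build : ∀ T' : Finset (Fin n), (∀ s, s ≠ i → s ≠ j → (s ∈ T ↔ s ∈ T')) →
      (i ∈ T' → i ∈ freeSet C') → (j ∈ T' → j ∈ freeSet C') →
      (countGE T' (j.val + 1) = countGE T (j.val + 1) →
        countGE T' j.val = countGE T' (j.val + 1) + (if j ∈ T' then 1 else 0) →
        countGE T' i.val = countGE T' j.val + (if i ∈ T' then 1 else 0) →
        countGE T' j.val ≤ countGE (pairSet C') j.val ∧
        countGE T' i.val + countGE (pairSet C) i.val =
          countGE (pairSet C') i.val + countGE T i.val ∧
        (i ∈ freeSet C' → i ∉ T' → countGE (pairSet C') i.val ≤ countGE T' i.val) ∧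
        (j ∈ freeSet C' → j ∉ T' → countGE (pairSet C') j.val ≤ countGE T' j.val)) →
      IsSplitSet (pairSet C') (freeSet C') T' := by
    intro T' hT h1 h2 h3
    have e1 := countGE_congr (S := T') (S' := T) (m := j.val + 1)
      fun s hs => (hT s (by rintro rfl; omega) (by rintro rfl; omega)).symm
    have e2 := countGE_succ T' i
    rw [← hij] at e2
    obtain ⟨a, b, c, d⟩ := h3 e1 (countGE_succ T' j) e2
    exact h.of_local hij hZ hF hT h1 h2 a b c d
  simp only [mem_freeSet, mem_pairSet, m1, m2, m3, m4] at *
  -- When both `i` and `j` are free, the greedy choice takes the greater letter `j` first.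
  have hmono : unbarred i ∉ C → unbarred j ∉ C → barred j ∉ C → barred i ∉ C → i ∈ T → j ∈ T := by
    grind
  -- In these configurations the split set stays put: in the first two the column itself is fixed,
  -- and in the third `j` and `ī` are both lowered, with neither `i` nor `j` free before or after.
  by_cases hsame : unbarred i ∈ C ∨ (unbarred j ∉ C ∧ barred j ∈ C) ∨
      (unbarred j ∈ C ∧ barred i ∈ C)
  · exact ⟨T, build T (fun _ _ _ => Iff.rfl) (by grind) (by grind) (by grind),
      fun _ _ _ => Iff.rfl, Or.inl ⟨hsame, rfl⟩, hmono⟩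
  obtain ⟨hu, hsame⟩ := not_or.1 hsame
  by_cases hv : unbarred j ∈ C
  · have hbu : barred i ∉ C := by tauto
    by_cases hbv : barred j ∈ C
    -- The pair `(j, j̄)` is broken into `i, j̄`. Counting forces `i ∈ T`, and `i` ceases to be
    -- free, so it leaves the split set together with the pair.
    · exact ⟨T.erase i, build _ (by grind) (by grind) (by grind) (by grind), by grind,
        Or.inr (Or.inr (Or.inr (Or.inr ⟨hu, hv, hbv, hbu, by grind, by grind, by grind⟩))), hmono⟩
    -- Among the four letters only `j` occurs and it becomes `i`: the free letter changes from `i`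
    -- to `j`, and membership in the split set follows.
    · refine ⟨if i ∈ T then insert j (T.erase i) else T, build _ (by grind) (by grind) (by grind)
        (by grind), by grind, Or.inr (Or.inr (Or.inl ⟨hu, hv, hbv, hbu, by grind, by grind⟩)), hmono⟩
  · have hbv : barred j ∉ C := by tauto
    by_cases hbu : barred i ∈ C
    -- Mirror case: `ī` becomes `j̄`, and the free letter changes from `j` to `i`.
    · refine ⟨if j ∈ T then insert i (T.erase j) else T, build _ (by grind) (by grind) (by grind)
        (by grind), by grind,
        Or.inr (Or.inr (Or.inr (Or.inl ⟨hu, hv, hbv, hbu, by grind, by grind⟩))), hmono⟩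
    · exact ⟨T, build T (fun _ _ _ => Iff.rfl) (by grind) (by grind) (by grind),
        fun _ _ _ => Iff.rfl, Or.inr (Or.inl ⟨hu, hv, hbv, hbu, rfl⟩), hmono⟩

theorem activeLower_sort_eq {S S' : Finset (Letter n)} {i : Fin n}
    (h : ∀ x, x ∈ activeLower i (S.sort (· ≤ ·)) ↔ x ∈ S') :
    activeLower i (S.sort (· ≤ ·)) = S'.sort (· ≤ ·) :=
  isColumn_eq_of_mem_iff ((isColumn_sort S).activeLower i) (isColumn_sort S') fun x => by
    rw [h, mem_sort]

-- Only the memberships of `i`, `j` and their barred versions can change, so everything reduces to a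
-- check over the local configurations of `exists_isSplitSet_activeLower`.
set_option maxHeartbeats 2000000 in
theorem exists_split_activeLower_of_succ {C : List (Letter n)} (hC : IsColumn C)
    {T : Finset (Fin n)} (h : IsSplitSet (pairSet C) (freeSet C) T) {i j : Fin n}
    (hij : j.val = i.val + 1) :
    ∃ T', IsSplitSet (pairSet (activeLower i C)) (freeSet (activeLower i C)) T' ∧
      activeLower i ((rightSet C T).sort (· ≤ ·)) =
        (rightSet (activeLower i C) T').sort (· ≤ ·) ∧
      (leftSet (activeLower i C) T' = leftSet C T ∨
        ((∀ p ∈ C, ¬ IsPlus i p) ∧ (∀ p ∈ leftSet C T, ¬ IsPlus i p) ∧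
          activeLower i ((leftSet C T).sort (· ≤ ·)) =
            (leftSet (activeLower i C) T').sort (· ≤ ·))) := by
  obtain ⟨T', hT', hoff, hloc, hmono⟩ := exists_isSplitSet_activeLower hC h hij
  have hne : j ≠ i := by rintro rfl; omega
  have hsi : i ∈ T → unbarred i ∉ C ∧ barred i ∉ C := fun hh => mem_freeSet.1 (h.subset hh)
  have hsj : j ∈ T → unbarred j ∉ C ∧ barred j ∉ C := fun hh => mem_freeSet.1 (h.subset hh)
  have ind : ∀ {P : Fin n → Prop}, P i → P j → (∀ s, s ≠ i → s.val ≠ i.val + 1 → s ≠ j → P s) →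
      ∀ s, P s := by
    intro P hi hj hs s
    by_cases h1 : s = i
    · exact h1 ▸ hi
    by_cases h2 : s = j
    · exact h2 ▸ hj
    exact hs s h1 (fun h => h2 (Fin.ext (by omega))) h2
  refine ⟨T', hT', activeLower_sort_eq ?_, ?_⟩
  · have hE := isColumn_sort (rightSet C T)
    rintro (s | s) <;> revert s <;> apply ind
    · simp only [unbarred_mem_activeLower hE hij, unbarred_mem_activeLower hC hij, mem_sort,
        unbarred_mem_rightSet]
    · simp only [unbarred_succ_mem_activeLower hE hij, unbarred_succ_mem_activeLower hC hij,
        mem_sort, unbarred_mem_rightSet]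
    · intro s h1 h2 h3
      simp only [unbarred_mem_activeLower_of_ne hE h1 h2, unbarred_mem_activeLower_of_ne hC h1 h2,
        mem_sort, unbarred_mem_rightSet]
    · simp only [barred_mem_activeLower hE hij, barred_mem_activeLower hC hij,
        unbarred_mem_activeLower hC hij, mem_sort, unbarred_mem_rightSet, barred_mem_rightSet]
      rcases hloc with ⟨hl | hl | hl, rfl⟩ | hl | hl | hl | hl <;> clear hoff ind <;> grind
    · simp only [barred_succ_mem_activeLower hE hij, barred_succ_mem_activeLower hC hij,
        unbarred_succ_mem_activeLower hC hij, mem_sort, unbarred_mem_rightSet, barred_mem_rightSet]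
      rcases hloc with ⟨hl | hl | hl, rfl⟩ | hl | hl | hl | hl <;> clear hoff ind <;> grind
    · intro s h1 h2 h3
      simp only [barred_mem_activeLower_of_ne hE h1 h2, barred_mem_activeLower_of_ne hC h1 h2,
        unbarred_mem_activeLower_of_ne hC h1 h2, mem_sort, barred_mem_rightSet, hoff s h1 h3]
  · have hE := isColumn_sort (leftSet C T)
    -- Commutation with `lC` is claimed only when something in `C` really moves and no plus letter
    -- is present in `C` or `lC`.
    by_cases hcase : (∀ p ∈ C, ¬ IsPlus i p) ∧ (∀ p ∈ leftSet C T, ¬ IsPlus i p) ∧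
        (unbarred j ∈ C ∨ barred i ∈ C)
    · refine Or.inr ⟨hcase.1, hcase.2.1, activeLower_sort_eq ?_⟩
      obtain ⟨c1, c2, c3⟩ := hcase
      simp only [isPlus_iff_of_succ hij] at c1 c2
      have d1 : unbarred i ∉ C := fun hh => c1 _ hh (Or.inl rfl)
      have d2 : barred j ∉ C := fun hh => c1 _ hh (Or.inr rfl)
      have d3 : unbarred i ∉ leftSet C T := fun hh => c2 _ hh (Or.inl rfl)
      rw [unbarred_mem_leftSet] at d3
      rintro (s | s) <;> revert s <;> apply ind
      · simp only [unbarred_mem_activeLower hE hij, unbarred_mem_activeLower hC hij,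
          barred_mem_activeLower hC hij, mem_sort, unbarred_mem_leftSet]
        rcases hloc with ⟨hl | hl | hl, rfl⟩ | hl | hl | hl | hl <;> clear hoff ind <;> grind
      · simp only [unbarred_succ_mem_activeLower hE hij, unbarred_succ_mem_activeLower hC hij,
          barred_succ_mem_activeLower hC hij, mem_sort, unbarred_mem_leftSet]
        rcases hloc with ⟨hl | hl | hl, rfl⟩ | hl | hl | hl | hl <;> clear hoff ind <;> grind
      · intro s h1 h2 h3
        simp only [unbarred_mem_activeLower_of_ne hE h1 h2, barred_mem_activeLower_of_ne hC h1 h2,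
          unbarred_mem_activeLower_of_ne hC h1 h2, mem_sort, unbarred_mem_leftSet, hoff s h1 h3]
      · simp only [barred_mem_activeLower hE hij, barred_mem_activeLower hC hij, mem_sort,
          unbarred_mem_leftSet, barred_mem_leftSet]
        rcases hloc with ⟨hl | hl | hl, rfl⟩ | hl | hl | hl | hl <;> clear hoff ind <;> grind
      · simp only [barred_succ_mem_activeLower hE hij, barred_succ_mem_activeLower hC hij, mem_sort,
          unbarred_mem_leftSet, barred_mem_leftSet]
        rcases hloc with ⟨hl | hl | hl, rfl⟩ | hl | hl | hl | hl <;> clear hoff ind <;> grind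
      · intro s h1 h2 h3
        simp only [barred_mem_activeLower_of_ne hE h1 h2, barred_mem_activeLower_of_ne hC h1 h2,
          mem_sort, barred_mem_leftSet]
    · refine Or.inl (Finset.ext ?_)
      -- In the remaining cases `lC` is fixed. When `i ∈ T` and `j ∈ C`, for instance, `lC` contains
      -- `i` from the split set before lowering and from the lowered `j` afterwards.
      have hcase' : unbarred i ∈ C ∨ barred j ∈ C ∨ i ∈ T ∨
          (unbarred j ∉ C ∧ barred i ∉ C) := by
        by_contra hcon
        simp only [not_or] at hcon
        refine hcase ⟨fun p hp hpp => ?_, fun p hp hpp => ?_, by tauto⟩ <;>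
          rcases (isPlus_iff_of_succ hij).1 hpp with rfl | rfl
        · exact hcon.1 hp
        · exact hcon.2.1 hp
        · rw [unbarred_mem_leftSet] at hp; tauto
        · rw [barred_mem_leftSet] at hp; tauto
      clear hcase
      rintro (s | s) <;> revert s <;> apply ind
      · simp only [unbarred_mem_activeLower hC hij, barred_mem_activeLower hC hij,
          unbarred_mem_leftSet]
        rcases hloc with ⟨hl | hl | hl, rfl⟩ | hl | hl | hl | hl <;> clear hoff ind <;> grind
      · simp only [unbarred_succ_mem_activeLower hC hij, barred_succ_mem_activeLower hC hij,
          unbarred_mem_leftSet]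
        rcases hloc with ⟨hl | hl | hl, rfl⟩ | hl | hl | hl | hl <;> clear hoff ind <;> grind
      · intro s h1 h2 h3
        simp only [barred_mem_activeLower_of_ne hC h1 h2,
          unbarred_mem_activeLower_of_ne hC h1 h2, unbarred_mem_leftSet, hoff s h1 h3]
      · simp only [barred_mem_activeLower hC hij, barred_mem_leftSet]
        rcases hloc with ⟨hl | hl | hl, rfl⟩ | hl | hl | hl | hl <;> clear hoff ind <;> grind
      · simp only [barred_succ_mem_activeLower hC hij, barred_mem_leftSet]
        rcases hloc with ⟨hl | hl | hl, rfl⟩ | hl | hl | hl | hl <;> clear hoff ind <;> grind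
      · intro s h1 h2 h3
        simp only [barred_mem_activeLower_of_ne hC h1 h2, barred_mem_leftSet]

/-- For the last index only `n̄ ↦ n` can occur, and only when `n ∉ C`. Pairs and free letters are
then the same before and after, so the split set is too. -/
theorem exists_split_activeLower_of_last {C : List (Letter n)} (hC : IsColumn C)
    {T : Finset (Fin n)} (h : IsSplitSet (pairSet C) (freeSet C) T) {i : Fin n}
    (hi : ¬ i.val + 1 < n) :
    IsSplitSet (pairSet (activeLower i C)) (freeSet (activeLower i C)) T ∧
      activeLower i ((rightSet C T).sort (· ≤ ·)) =
        (rightSet (activeLower i C) T).sort (· ≤ ·) ∧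
      (leftSet (activeLower i C) T = leftSet C T ∨
        ((∀ p ∈ C, ¬ IsPlus i p) ∧ (∀ p ∈ leftSet C T, ¬ IsPlus i p) ∧
          activeLower i ((leftSet C T).sort (· ≤ ·)) =
            (leftSet (activeLower i C) T).sort (· ≤ ·))) := by
  have m1 := unbarred_mem_activeLower_last hC hi
  have m2 := barred_mem_activeLower_last hC hi
  have m3 : ∀ s, s ≠ i → (unbarred s ∈ activeLower i C ↔ unbarred s ∈ C) :=
    fun s h1 => unbarred_mem_activeLower_of_ne hC h1 (by omega)
  have m4 : ∀ s, s ≠ i → (barred s ∈ activeLower i C ↔ barred s ∈ C) :=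
    fun s h1 => barred_mem_activeLower_of_ne hC h1 (by omega)
  have ind : ∀ {P : Fin n → Prop}, P i → (∀ s, s ≠ i → P s) → ∀ s, P s := by
    intro P hi hs s
    by_cases h1 : s = i
    · exact h1 ▸ hi
    exact hs s h1
  have hZ : pairSet (activeLower i C) = pairSet C := by
    apply Finset.ext
    apply ind
    · simp only [mem_pairSet, m1, m2]; tauto
    · intro s hs; simp only [mem_pairSet, m3 s hs, m4 s hs]
  have hF : freeSet (activeLower i C) = freeSet C := by
    apply Finset.ext
    apply ind
    · simp only [mem_freeSet, m1, m2]; tauto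
    · intro s hs; simp only [mem_freeSet, m3 s hs, m4 s hs]
  -- the last letter is not in the split set, since no pair lies above it
  have hiT : i ∉ T := by
    intro hiT
    have h1 := h.count_le i.val
    have h2 := countGE_succ T i
    have h3 : countGE (pairSet C) i.val = 0 := by
      unfold countGE
      rw [card_eq_zero, filter_eq_empty_iff]
      intro s hs hle
      have : s = i := Fin.ext (by omega)
      subst this
      exact (mem_freeSet.1 (h.subset hiT)).1 (mem_pairSet.1 hs).1
    rw [if_pos hiT] at h2
    omega
  refine ⟨by rw [hZ, hF]; exact h, activeLower_sort_eq ?_, ?_⟩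
  · have hE := isColumn_sort (rightSet C T)
    rintro (s | s) <;> revert s <;> apply ind
    · simp only [unbarred_mem_activeLower_last hE hi, m1, mem_sort, unbarred_mem_rightSet,
        barred_mem_rightSet]
      tauto
    · intro s hs
      simp only [unbarred_mem_activeLower_of_ne hE hs (by omega), m3 s hs, mem_sort,
        unbarred_mem_rightSet]
    · simp only [barred_mem_activeLower_last hE hi, m1, m2, mem_sort, unbarred_mem_rightSet,
        barred_mem_rightSet]
      tauto
    · intro s hs
      simp only [barred_mem_activeLower_of_ne hE hs (by omega), m3 s hs, m4 s hs, mem_sort,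
        barred_mem_rightSet]
  · have hE := isColumn_sort (leftSet C T)
    by_cases hu : unbarred i ∈ C
    · refine Or.inl (Finset.ext ?_)
      rintro (s | s) <;> revert s <;> apply ind
      · simp only [unbarred_mem_leftSet, m1, m2]; tauto
      · intro s hs; simp only [unbarred_mem_leftSet, m3 s hs, m4 s hs]
      · simp only [barred_mem_leftSet, m2]; tauto
      · intro s hs; simp only [barred_mem_leftSet, m4 s hs]
    · refine Or.inr ⟨?_, ?_, activeLower_sort_eq ?_⟩
      · simp only [isPlus_iff_of_last hi]
        rintro p hp rfl; exact hu hp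
      · simp only [isPlus_iff_of_last hi]
        rintro p hp rfl
        rw [unbarred_mem_leftSet] at hp
        tauto
      · rintro (s | s) <;> revert s <;> apply ind
        · simp only [unbarred_mem_activeLower_last hE hi, m1, m2, mem_sort, unbarred_mem_leftSet,
            barred_mem_leftSet]
          tauto
        · intro s hs
          simp only [unbarred_mem_activeLower_of_ne hE hs (by omega), m3 s hs, m4 s hs, mem_sort,
            unbarred_mem_leftSet]
        · simp only [barred_mem_activeLower_last hE hi, m2, mem_sort, unbarred_mem_leftSet,
            barred_mem_leftSet]
          tauto
        · intro s hs
          simp only [barred_mem_activeLower_of_ne hE hs (by omega), m4 s hs, mem_sort,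
            barred_mem_leftSet]

/-- Lowering a column commutes with `C ↦ rC`. It either leaves `lC` unchanged, or it commutes with
`C ↦ lC` and neither `C` nor `lC` contains a letter of `{(i+1)‾, i}`. -/
theorem IsSplitList.exists_activeLower {C : List (Letter n)} (hC : IsColumn C)
    {J : List (Fin n)} (h : IsSplitList C J) (i : Fin n) :
    ∃ J', IsSplitList (activeLower i C) J' ∧
      rightCol (activeLower i C) J' = activeLower i (rightCol C J) ∧
      (leftCol (activeLower i C) J' = leftCol C J ∨
        ((∀ p ∈ C, ¬ IsPlus i p) ∧ (∀ p ∈ leftCol C J, ¬ IsPlus i p) ∧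
          leftCol (activeLower i C) J' = activeLower i (leftCol C J))) := by
  obtain ⟨T', hT', hr, hl⟩ : ∃ T',
      IsSplitSet (pairSet (activeLower i C)) (freeSet (activeLower i C)) T' ∧
      activeLower i ((rightSet C J.toFinset).sort (· ≤ ·)) =
        (rightSet (activeLower i C) T').sort (· ≤ ·) ∧
      (leftSet (activeLower i C) T' = leftSet C J.toFinset ∨
        ((∀ p ∈ C, ¬ IsPlus i p) ∧ (∀ p ∈ leftSet C J.toFinset, ¬ IsPlus i p) ∧
          activeLower i ((leftSet C J.toFinset).sort (· ≤ ·)) =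
            (leftSet (activeLower i C) T').sort (· ≤ ·))) := by
    by_cases hi : i.val + 1 < n
    · exact exists_split_activeLower_of_succ hC h.isSplitSet (j := ⟨i.val + 1, hi⟩) rfl
    · exact ⟨_, exists_split_activeLower_of_last hC h.isSplitSet hi⟩
  obtain ⟨J', hJ', rfl⟩ := hT'.exists_isSplitList
  refine ⟨J', hJ', ?_, ?_⟩
  · rw [rightCol_eq, rightCol_eq, hr]
  · rw [leftCol_eq, leftCol_eq]
    rcases hl with hl | ⟨h1, h2, h3⟩
    · exact Or.inl (by rw [hl])
    · exact Or.inr ⟨h1, fun p hp => h2 p (by simpa using hp), h3.symm⟩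

theorem IsAdmissible.activeLower {C : List (Letter n)} (h : IsAdmissible C) (i : Fin n) :
    IsAdmissible (activeLower i C) := by
  obtain ⟨hC, J, hJ⟩ := h
  obtain ⟨J', hJ', -⟩ := hJ.exists_activeLower hC i
  exact ⟨hC.activeLower i, J', hJ'⟩

/-! ### From one column to tableaux -/

/-- The column `rC` contains no pair. -/
theorem barred_notMem_rightCol {C : List (Letter n)} {J : List (Fin n)} (h : IsSplitList C J)
    {i : Fin n} (hi : unbarred i ∈ rightCol C J) : barred i ∉ rightCol C J := by
  rw [rightCol_eq, mem_sort] at hi ⊢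
  rw [unbarred_mem_rightSet] at hi
  rw [barred_mem_rightSet]
  rintro (h' | h')
  · exact h'.2 hi
  · exact (mem_freeSet.1 (h.isSplitSet.subset h')).1 hi

/-- When `lD` is fixed, lowering `rC` only decreases its entries. Otherwise `lD` has no plus letter
and `rC` has no pair, as the monotonicity lemma requires. -/
theorem SplitLE.activeLower {C D : List (Letter n)} (hC : IsColumn C) (hD : IsColumn D)
    (h : SplitLE C D) (i : Fin n) :
    SplitLE (activeLower i C) (activeLower i D) := by
  obtain ⟨J₁, J₂, h₁, h₂, hle⟩ := h
  obtain ⟨J₁', h₁', hr, -⟩ := h₁.exists_activeLower hC i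
  obtain ⟨J₂', h₂', -, hl⟩ := h₂.exists_activeLower hD i
  have c₁ : IsColumn (rightCol C J₁) := isColumn_sort _
  have c₂ : IsColumn (leftCol D J₂) := isColumn_sort _
  refine ⟨J₁', J₂', h₁', h₂', ?_⟩
  rw [hr]
  rcases hl with hl | ⟨-, hl', hl⟩
  · rw [hl]; exact hle.activeLower_left c₁ i
  · rw [hl]; exact hle.activeLower c₁ c₂ i hl' (barred_notMem_rightCol h₁)

/-- This is the boundary between lowered and untouched columns: a plus letter in `D` excludes the
alternative in which `lD` changes. -/
theorem SplitLE.activeLower_right {C D : List (Letter n)} (hD : IsColumn D)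
    (h : SplitLE C D) {i : Fin n} (hp : ∃ p ∈ D, IsPlus i p) :
    SplitLE C (SymplecticTableaux.activeLower i D) := by
  obtain ⟨J₁, J₂, h₁, h₂, hle⟩ := h
  obtain ⟨J₂', h₂', -, hl⟩ := h₂.exists_activeLower hD i
  refine ⟨J₁, J₂', h₁, h₂', ?_⟩
  rcases hl with hl | ⟨hl', -, hl⟩
  · rwa [hl]
  · obtain ⟨p, hp, hp'⟩ := hp
    exact absurd hp' (hl' p hp)

/-- The columns, from right to left, of a filling whose reading is lowered by `activeLower`. -/
def lowerCols (i : Fin n) : List (List (Letter n)) → List (List (Letter n))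
  | [] => []
  | C :: R => activeLower i C :: if ∀ p ∈ C, ¬ IsPlus i p then lowerCols i R else R

theorem flatten_lowerCols (i : Fin n) (R : List (List (Letter n))) :
    (lowerCols i R).flatten = activeLower i R.flatten := by
  induction R with
  | nil => rfl
  | cons C R ih =>
    simp only [lowerCols]
    split_ifs with h
    · rw [List.flatten_cons, List.flatten_cons, activeLower_append_of_forall h, ih]
    · push Not at h
      rw [List.flatten_cons, List.flatten_cons, activeLower_append_of_exists h]

theorem map_length_lowerCols (i : Fin n) (R : List (List (Letter n))) :
    (lowerCols i R).map List.length = R.map List.length := by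
  induction R with
  | nil => rfl
  | cons C R ih =>
    simp only [lowerCols]
    split_ifs <;> simp [ih]

theorem isAdmissible_of_mem_lowerCols {i : Fin n} {R : List (List (Letter n))}
    (h : ∀ C ∈ R, IsAdmissible C) : ∀ C ∈ lowerCols i R, IsAdmissible C := by
  induction R with
  | nil => simp [lowerCols]
  | cons D R ih =>
    simp only [List.mem_cons, forall_eq_or_imp] at h
    simp only [lowerCols, List.mem_cons, forall_eq_or_imp]
    refine ⟨h.1.activeLower i, ?_⟩
    split_ifs
    · exact ih h.2
    · exact h.2

theorem isChain_lowerCols {i : Fin n} {R : List (List (Letter n))}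
    (h : ∀ C ∈ R, IsColumn C) (hR : R.IsChain fun D C => SplitLE C D) :
    (lowerCols i R).IsChain fun D C => SplitLE C D := by
  induction R with
  | nil => simp [lowerCols]
  | cons D R ih =>
    simp only [List.mem_cons, forall_eq_or_imp] at h
    rw [lowerCols]
    cases R with
    | nil => simp [lowerCols]
    | cons C R =>
      rw [List.isChain_cons_cons] at hR
      split_ifs with hp
      · have := ih h.2 hR.2
        rw [lowerCols] at this ⊢
        rw [List.isChain_cons_cons]
        exact ⟨hR.1.activeLower (h.2 C (by simp)) h.1 i, this⟩
      · push Not at hp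
        rw [List.isChain_cons_cons]
        exact ⟨hR.1.activeLower_right h.1 hp, hR.2⟩

/-- The filling with the same shape as `T` whose reading is `activeLower i (reading T)`. -/
def lowerTableau (i : Fin n) (T : Filling n) : Filling n := (lowerCols i T.reverse).reverse

theorem reading_lowerTableau (i : Fin n) (T : Filling n) :
    reading (lowerTableau i T) = activeLower i (reading T) := by
  rw [reading, lowerTableau, List.reverse_reverse, flatten_lowerCols]; rfl

theorem map_length_lowerTableau (i : Fin n) (T : Filling n) :
    (lowerTableau i T).map List.length = T.map List.length := by
  rw [lowerTableau, List.map_reverse, map_length_lowerCols, List.map_reverse, List.reverse_reverse]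

theorem isSymplecticTableau_lowerTableau {lam : Fin n → ℕ} {T : Filling n}
    (h : IsSymplecticTableau lam T) (i : Fin n) : IsSymplecticTableau lam (lowerTableau i T) := by
  obtain ⟨h1, h2, h3⟩ := h
  refine ⟨by rw [map_length_lowerTableau, h1], ?_, ?_⟩
  · intro C hC
    refine isAdmissible_of_mem_lowerCols (i := i) (R := T.reverse)
      (fun D hD => h2 D (by simpa using hD)) C ?_
    simpa [lowerTableau] using hC
  · rw [lowerTableau, List.isChain_reverse]
    apply isChain_lowerCols
    · intro D hD; exact (h2 D (by simpa using hD)).1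
    · rw [List.isChain_reverse]; exact h3

theorem eq_of_reading_eq {T T' : Filling n} (h : reading T = reading T')
    (hl : T.map List.length = T'.map List.length) : T = T' := by
  apply List.reverse_injective
  rw [List.eq_iff_flatten_eq]
  exact ⟨h, by rw [List.map_reverse, List.map_reverse, hl]⟩

end SymplecticTableaux

/-! ### The step as a lowering of the reading -/

namespace SymplecticTableaux

open Letter

variable {n : ℕ}

/-- Positions before `a` carry nothing relevant. Up to `b` no plus letter has appeared, so minus
letters are lowered on both sides; beyond `b` every minus letter is blocked. -/
theorem mapIdx_eq_activeLower {w : List (Letter n)} {i : Fin n} {a b : ℕ}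
    (hpre : ∀ d < a, ∀ z, w[d]? = some z → ¬ IsPlus i z ∧ ¬ IsMinus i z)
    (hb : IsGreatest {c | a ≤ c ∧ (∃ y, w[c]? = some y ∧ IsMinus i y) ∧
      ∀ d, a ≤ d → d ≤ c → ∀ z, w[d]? = some z → ¬ IsPlus i z} b) :
    (w.mapIdx fun c z => if a ≤ c ∧ c ≤ b then (eTilde i z).getD z else z) = activeLower i w := by
  apply List.ext_getElem?
  intro c
  rw [getElem?_activeLower, List.getElem?_mapIdx]
  cases hw : w[c]? with
  | none => rfl
  | some z =>
    simp only [Option.map_some, Option.some.injEq]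
    change (if a ≤ c ∧ c ≤ b then lower i z else z) = _
    have hmem : (∃ p ∈ w.take (c + 1), IsPlus i p) ↔ ∃ d ≤ c, ∃ p, w[d]? = some p ∧ IsPlus i p := by
      constructor
      · rintro ⟨p, hp, hpp⟩
        obtain ⟨d, hd⟩ := List.mem_iff_getElem?.1 hp
        rw [List.getElem?_take] at hd
        split_ifs at hd with hdc
        exact ⟨d, by omega, p, hd, hpp⟩
      · rintro ⟨d, hd, p, hp, hpp⟩
        refine ⟨p, List.mem_iff_getElem?.2 ⟨d, ?_⟩, hpp⟩
        rw [List.getElem?_take, if_pos (by omega), hp]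
    by_cases hm : IsMinus i z
    swap
    · simp [lower_of_not_isMinus hm]
    have hac : a ≤ c := by
      by_contra hcon
      exact (hpre c (by omega) z hw).2 hm
    by_cases hcb : c ≤ b
    · rw [if_pos ⟨hac, hcb⟩, if_neg]
      rw [hmem]
      rintro ⟨d, hd, p, hp, hpp⟩
      by_cases had : a ≤ d
      · exact hb.1.2.2 d had (hd.trans hcb) p hp hpp
      · exact (hpre d (by omega) p hp).1 hpp
    · rw [if_neg (fun h => hcb h.2), if_pos]
      rw [hmem]
      -- An unblocked minus letter beyond `b` would contradict the maximality of `b`.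
      by_contra hcon
      push Not at hcon
      exact hcb (hb.2 ⟨hac, ⟨z, hw, hm⟩, fun d _ hd p hp => hcon d hd p hp⟩)

theorem sum_rank_activeLower_le (i : Fin n) (w : List (Letter n)) :
    ((activeLower i w).map rank).sum ≤ (w.map rank).sum := by
  induction w with
  | nil => simp [activeLower]
  | cons z w ih =>
    simp only [activeLower]
    split_ifs
    · exact le_rfl
    · have := le_iff_rank_le.1 (lower_le i z)
      simp only [List.map_cons, List.sum_cons]
      omega

/-- Termination measure: the unblocked minus letter `x` loses one unit of rank and no letter gains
any. -/
theorem sum_rank_activeLower_lt {i : Fin n} {w : List (Letter n)} {a : ℕ} {x : Letter n}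
    (hx : w[a]? = some x) (hm : IsMinus i x)
    (hpre : ∀ d < a, ∀ z, w[d]? = some z → ¬ IsPlus i z) :
    ((activeLower i w).map rank).sum < (w.map rank).sum := by
  induction w generalizing a with
  | nil => simp at hx
  | cons z w ih =>
    cases a with
    | zero =>
      simp only [List.getElem?_cons_zero, Option.some.injEq] at hx
      subst hx
      have h1 := rank_lower_add_one hm
      have h2 := sum_rank_activeLower_le i w
      rw [activeLower, if_neg (fun h => h.not_isMinus hm)]
      simp only [List.map_cons, List.sum_cons]
      omega
    | succ a =>
      rw [activeLower, if_neg (hpre 0 (by omega) z (by simp))]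
      have h1 := le_iff_rank_le.1 (lower_le i z)
      have h2 := ih (a := a) (by simpa using hx)
        (fun d hd z hz => hpre (d + 1) (by omega) z (by simpa using hz))
      simp only [List.map_cons, List.sum_cons]
      omega

/-! ### Movable letters and highest weight columns -/

theorem Letter.rank_lt (x : Letter n) : x.rank < 2 * n := by
  rcases x with j | j <;> simp only [rank_unbarred, rank_barred] <;> omega

theorem Letter.exists_rank_eq {m : ℕ} (h : m < 2 * n) : ∃ x : Letter n, x.rank = m := by
  by_cases hm : m < n
  · exact ⟨unbarred ⟨m, hm⟩, rfl⟩
  · exact ⟨barred ⟨2 * n - 1 - m, by omega⟩, by simp only [rank_barred]; omega⟩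

theorem Letter.isGreatest_lt_iff {x q : Letter n} :
    IsGreatest {y | y < x} q ↔ q.rank + 1 = x.rank := by
  constructor
  · rintro ⟨h1, h2⟩
    have h1 : q.rank < x.rank := h1
    by_contra hne
    obtain ⟨y, hy⟩ := exists_rank_eq (n := n) (m := q.rank + 1) (by have := x.rank_lt; omega)
    have : y.rank ≤ q.rank := h2 (show y.rank < x.rank by omega)
    omega
  · intro h
    refine ⟨show q.rank < x.rank by omega, fun y hy => ?_⟩
    have hy : y.rank < x.rank := hy
    exact show y.rank ≤ q.rank by omega

theorem Letter.exists_isMinus {x : Letter n} (h : 0 < x.rank) : ∃ i, IsMinus i x := by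
  rcases x with j | j
  · exact ⟨⟨j.val - 1, by omega⟩, by simp only [rank_unbarred] at h; simp; omega⟩
  · exact ⟨j, rfl⟩

theorem Letter.isMinus_unique {i i' : Fin n} {x : Letter n} (h : IsMinus i x)
    (h' : IsMinus i' x) : i = i' := by
  rcases x with j | j
  · simp only [isMinus_unbarred] at h h'; exact Fin.ext (by omega)
  · simp only [isMinus_barred] at h h'; rw [← h, h']

theorem Letter.eq_unbarred_of_rank_eq {x : Letter n} {j : Fin n} (h : x.rank = j.val) :
    x = unbarred j := rank_injective h

theorem Letter.not_isPlus_and_not_isMinus_of_rank_lt {i : Fin n} {z : Letter n}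
    (h : z.rank < i.val) : ¬ IsPlus i z ∧ ¬ IsMinus i z := by
  rcases z with j | j
  · simp only [rank_unbarred] at h
    simp only [isPlus_unbarred, isMinus_unbarred, Fin.ext_iff]; omega
  · simp only [rank_barred] at h
    omega

theorem IsColumn.rank_lt {C : List (Letter n)} (hC : IsColumn C) {k m : ℕ} (hk : k < C.length)
    (hm : m < C.length) (h : k < m) : (C[k]).rank < (C[m]).rank :=
  List.pairwise_iff_getElem.1 hC k m hk hm h

theorem IsColumn.le_rank {C : List (Letter n)} (hC : IsColumn C) {k : ℕ} (hk : k < C.length) :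
    k ≤ (C[k]).rank := by
  induction k with
  | zero => omega
  | succ k ih =>
    have h1 := ih (by omega)
    have h2 := hC.rank_lt (show k < C.length by omega) hk (Nat.lt_succ_self k)
    omega

theorem length_highestCol {p : ℕ} (h : p ≤ n) : (highestCol n p).length = p := by
  simp [highestCol, h]

theorem rank_getElem_highestCol {p k : ℕ} (hk : k < (highestCol n p).length) :
    ((highestCol n p)[k]).rank = k := by
  simp [highestCol]

theorem rank_lt_of_mem_highestCol {p : ℕ} {z : Letter n} (hz : z ∈ highestCol n p) :
    z.rank < p := by
  obtain ⟨k, hk, rfl⟩ := List.getElem_of_mem hz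
  rw [rank_getElem_highestCol]
  simp [highestCol] at hk
  omega

theorem isColumn_highestCol (p : ℕ) : IsColumn (highestCol n p) := by
  rw [IsColumn, List.pairwise_iff_getElem]
  intro a b ha hb hab
  rw [lt_iff_rank_lt, rank_getElem_highestCol, rank_getElem_highestCol]
  exact hab

/-- A column that is not of highest weight starts with `1, …, p`, followed by a letter that is
greater than `p + 1`. -/
theorem IsColumn.exists_prefix {C : List (Letter n)} (hC : IsColumn C) (hlen : C.length ≤ n)
    (hne : C ≠ highestCol n C.length) :
    ∃ p, ∃ hp : p < C.length, (∀ j (hj : j < p), (C[j]).rank = j) ∧ p < (C[p]).rank := by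
  classical
  have hex : ∃ p, ∃ hp : p < C.length, (C[p]).rank ≠ p := by
    by_contra hcon
    push Not at hcon
    apply hne
    refine List.ext_getElem (length_highestCol hlen).symm fun k h1 h2 => ?_
    apply rank_injective
    rw [hcon k h1, rank_getElem_highestCol]
  obtain ⟨hp, hpr⟩ := Nat.find_spec hex
  refine ⟨Nat.find hex, hp, fun j hj => ?_, ?_⟩
  · by_contra hcon
    exact Nat.find_min hex hj ⟨hj.trans hp, hcon⟩
  · exact lt_of_le_of_ne (hC.le_rank hp) (Ne.symm hpr)

theorem IsColumn.rank_le_of_prefix {C : List (Letter n)} (hC : IsColumn C) {p : ℕ}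
    (hp : p < C.length) (hpre : ∀ j (hj : j < p), (C[j]).rank = j) {z : Letter n} (hz : z ∈ C)
    (h1 : p ≤ z.rank) : (C[p]).rank ≤ z.rank := by
  obtain ⟨k, hk, rfl⟩ := List.getElem_of_mem hz
  rcases lt_trichotomy k p with h | rfl | h
  · have := hpre k h; omega
  · exact le_rfl
  · exact (hC.rank_lt hp hk h).le

/-- The predecessor of the first letter out of place falls in the gap left by the prefix. A letter
of rank less than `p` other than `1` has its predecessor in the prefix. -/
theorem IsColumn.isLeast_isMovable {C : List (Letter n)} (hC : IsColumn C) {p : ℕ}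
    (hp : p < C.length) (hpre : ∀ j (hj : j < p), (C[j]).rank = j) (hpr : p < (C[p]).rank) :
    IsLeast {z | IsMovable C z} C[p] := by
  constructor
  · obtain ⟨q, hq⟩ := exists_rank_eq (n := n) (m := (C[p]).rank - 1)
      (by have := (C[p]).rank_lt; omega)
    refine ⟨List.getElem_mem hp, q, isGreatest_lt_iff.2 (by omega), fun hqC => ?_⟩
    have := hC.rank_le_of_prefix hp hpre hqC (by omega)
    omega
  · rintro z ⟨hz, q, hq, hqC⟩
    rw [isGreatest_lt_iff] at hq
    rw [le_iff_rank_le]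
    apply hC.rank_le_of_prefix hp hpre hz
    by_contra hcon
    apply hqC
    have h1 := hpre q.rank (by omega)
    rw [← rank_injective h1]
    exact List.getElem_mem _

/-- If the least movable letter of an admissible column belongs to `{ī, i+1}`, then it is preceded
by letters smaller than `i`. -/
theorem IsAdmissible.le_of_isMinus {C : List (Letter n)} (hC : IsAdmissible C) {p : ℕ}
    (hp : p < C.length) (hpre : ∀ j (hj : j < p), (C[j]).rank = j) (hpr : p < (C[p]).rank)
    {i : Fin n} (hi : IsMinus i C[p]) : p ≤ i.val := by
  by_contra hcon
  obtain ⟨_, J, hJ⟩ := hC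
  have hmem : ∀ t : Fin n, t.val < p → unbarred t ∈ C := by
    intro t ht
    rw [← eq_unbarred_of_rank_eq (hpre t.val ht)]
    exact List.getElem_mem _
  cases hx : C[p] with
  | unbarred j =>
    rw [hx] at hi hpr
    simp only [isMinus_unbarred, rank_unbarred] at hi hpr
    omega
  | barred j =>
    rw [hx] at hi
    obtain rfl := isMinus_barred.1 hi
    have hz : j ∈ pairLetters C :=
      mem_pairLetters.2 ⟨hmem j (by omega), hx ▸ List.getElem_mem hp⟩
    obtain ⟨k, hk, hkz⟩ := List.getElem_of_mem hz
    have h1 := (hJ.2 k hk (hJ.1 ▸ hk)).1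
    have h2 := h1.1
    rw [hkz, Fin.lt_def] at h2
    -- A pair `(j, j̄)` inside the prefix leaves no free letter below `j`, contrary to
    -- admissibility.
    exact h1.2.2.1 (hmem _ (by omega))

/-- A highest weight neighbour `D` equals its own `lD`, so a taller `D` would force letters of rank
at most `p` in row `p` of `rC`, where `C` has a gap. -/
theorem SplitLE.length_le_of_highestCol {C D : List (Letter n)} (h : SplitLE C D) {p : ℕ}
    (hC : IsColumn C) (hp : p < C.length) (hpre : ∀ j (hj : j < p), (C[j]).rank = j)
    (hpr : p < (C[p]).rank) (hD : D = highestCol n D.length) (hDn : D.length ≤ n) :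
    D.length ≤ p := by
  by_contra hcon
  obtain ⟨J₁, J₂, -, h₂, hle⟩ := h
  have hpair : pairLetters D = [] := by
    rw [List.eq_nil_iff_forall_not_mem]
    intro z hz
    have h1 := (mem_pairLetters.1 hz).2
    rw [hD] at h1
    have h2 := rank_lt_of_mem_highestCol h1
    simp only [rank_barred] at h2
    omega
  have hJ : J₂ = [] := by
    have := h₂.1
    rw [hpair] at this
    exact List.length_eq_zero_iff.1 this
  have hleft : leftCol D J₂ = D := by
    apply isColumn_eq_of_mem_iff (isColumn_sort _)
    · rw [hD]; exact isColumn_highestCol _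
    · intro x
      simp [hpair, hJ]
  rw [hleft] at hle
  have hpD : p < D.length := by omega
  have hpR : p < (rightCol C J₁).length := hpD.trans_le hle.1
  have h1 : ((rightCol C J₁)[p]).rank ≤ (D[p]).rank := hle.2 p hpR hpD
  have h2 : (D[p]).rank = p := by
    have := rank_getElem_highestCol (n := n) (p := D.length) (k := p) (by rwa [← hD])
    simpa only [← hD] using this
  have hcol : IsColumn (rightCol C J₁) := isColumn_sort _
  have h3 := hcol.le_rank hpR
  -- The rank is at most `p` by the row inequality and at least `p` by strict increase. The entry is
  -- unbarred since `p < n`, and `rC` has the same unbarred letters as `C`.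
  have h4 : (rightCol C J₁)[p] = unbarred ⟨p, by omega⟩ :=
    eq_unbarred_of_rank_eq (by simp only; omega)
  have h5 : unbarred ⟨p, by omega⟩ ∈ rightCol C J₁ := h4 ▸ List.getElem_mem hpR
  rw [rightCol_eq, Finset.mem_sort, unbarred_mem_rightSet] at h5
  have h6 := hC.rank_le_of_prefix hp hpre h5 (by simp)
  simp only [rank_unbarred] at h6
  omega

theorem le_of_mem_heights {lam : Fin n → ℕ} {h : ℕ} (hh : h ∈ heights lam) : h ≤ n := by
  simp only [heights, List.mem_flatMap, List.mem_replicate] at hh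
  obtain ⟨j, -, -, rfl⟩ := hh
  omega

theorem heights_pairwise (lam : Fin n → ℕ) : (heights lam).Pairwise (· ≥ ·) := by
  rw [heights, List.pairwise_flatMap]
  refine ⟨fun j _ => List.pairwise_replicate.2 (Or.inr le_rfl), ?_⟩
  rw [List.pairwise_reverse]
  refine (List.pairwise_lt_finRange n).imp ?_
  intro a b hab x hx y hy
  rw [List.mem_replicate] at hx hy
  rw [Fin.lt_def] at hab
  omega

theorem IsSymplecticTableau.length_le {lam : Fin n → ℕ} {T : Filling n}
    (hT : IsSymplecticTableau lam T) {C : List (Letter n)} (hC : C ∈ T) : C.length ≤ n :=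
  le_of_mem_heights (hT.1 ▸ List.mem_map_of_mem hC)

theorem reading_eq_of_getElem? {T : Filling n} {k : ℕ} {C : List (Letter n)}
    (hk : T[k]? = some C) :
    reading T = reading (T.drop (k + 1)) ++ (C ++ reading (T.take k)) := by
  obtain ⟨hlt, rfl⟩ := List.getElem?_eq_some_iff.1 hk
  have h : T = T.take k ++ T[k] :: T.drop (k + 1) := by simp
  refine (congrArg reading h).trans ?_
  simp only [reading, List.reverse_append, List.reverse_cons, List.flatten_append,
    List.flatten_cons, List.flatten_nil, List.append_nil, List.append_assoc]

/-- In the reading of a symplectic tableau, no letter of `{ī, i+1}` or `{(i+1)‾, i}` precedes the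
letter `x` chosen by the algorithm. -/
theorem IsSymplecticTableau.reading_prefix {lam : Fin n → ℕ} {T : Filling n}
    (hT : IsSymplecticTableau lam T) {k : ℕ} {C : List (Letter n)} {x : Letter n} {i : Fin n}
    (hk : T[k]? = some C) (hne : C ≠ highestCol n C.length)
    (hright : ∀ D ∈ T.drop (k + 1), D = highestCol n D.length)
    (hx : IsLeast {z | IsMovable C z} x) (hi : IsMinus i x) :
    (reading T)[(reading (T.drop (k + 1))).length + C.idxOf x]? = some x ∧
      ∀ d < (reading (T.drop (k + 1))).length + C.idxOf x, ∀ z, (reading T)[d]? = some z →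
        ¬ IsPlus i z ∧ ¬ IsMinus i z := by
  have hCT : C ∈ T := List.mem_of_getElem? hk
  have hadm := hT.2.1 C hCT
  have hcol := hadm.1
  obtain ⟨p, hp, hpre, hpr⟩ := hcol.exists_prefix (hT.length_le hCT) hne
  obtain rfl := hx.unique (hcol.isLeast_isMovable hp hpre hpr)
  have hpi := hadm.le_of_isMinus hp hpre hpr hi
  have hidx : C.idxOf C[p] = p :=
    List.Nodup.idxOf_getElem (List.Pairwise.imp (fun h => ne_of_lt h) hcol) p hp
  obtain ⟨hkT, hkC⟩ := List.getElem?_eq_some_iff.1 hk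
  have hlen : ∀ D ∈ T.drop (k + 1), D.length ≤ p := by
    intro D hD
    obtain ⟨m, hm, rfl⟩ := List.getElem_of_mem hD
    rw [List.length_drop] at hm
    have hk1 : k + 1 < T.length := by omega
    have h1 := List.isChain_iff_getElem.1 hT.2.2 k hk1
    rw [hkC] at h1
    have h2 : T[k + 1].length ≤ p :=
      h1.length_le_of_highestCol hcol hp hpre hpr
        (hright _ (List.mem_drop_iff_getElem.2 ⟨0, by omega, by simp⟩))
        (hT.length_le (List.getElem_mem _))
    -- The bound on the adjacent column reaches all columns further right, because heights weakly
    -- decrease.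
    have h3 : (T.map List.length).Pairwise (· ≥ ·) := hT.1 ▸ heights_pairwise lam
    rw [List.getElem_drop]
    rcases Nat.eq_zero_or_pos m with rfl | hm0
    · exact h2
    · have h4 := List.pairwise_iff_getElem.1 h3 (k + 1) (k + 1 + m) (by simpa using hk1)
        (by simp; omega) (by omega)
      simp only [List.getElem_map] at h4
      exact le_trans h4 h2
  have hsmall : ∀ z ∈ reading (T.drop (k + 1)), z.rank < p := by
    intro z hz
    simp only [reading, List.mem_flatten, List.mem_reverse] at hz
    obtain ⟨D, hD, hzD⟩ := hz
    rw [hright D hD] at hzD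
    exact (rank_lt_of_mem_highestCol hzD).trans_le (hlen D hD)
  rw [hidx, reading_eq_of_getElem? hk]
  constructor
  · rw [List.getElem?_append_right (by omega), Nat.add_sub_cancel_left,
      List.getElem?_append_left hp, List.getElem?_eq_getElem hp]
  · intro d hd z hz
    apply not_isPlus_and_not_isMinus_of_rank_lt
    refine lt_of_lt_of_le ?_ hpi
    by_cases hd1 : d < (reading (T.drop (k + 1))).length
    · rw [List.getElem?_append_left hd1] at hz
      exact hsmall z (List.mem_of_getElem? hz)
    · rw [List.getElem?_append_right (by omega), List.getElem?_append_left (by omega)] at hz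
      obtain ⟨hlt, rfl⟩ := List.getElem?_eq_some_iff.1 hz
      rw [hpre _ (by omega)]
      omega

/-! ### Existence, uniqueness and termination -/

theorem exists_rightmost {α : Type*} {P : α → Prop} {L : List α} (h : ∃ a ∈ L, ¬ P a) :
    ∃ k a, L[k]? = some a ∧ ¬ P a ∧ ∀ b ∈ L.drop (k + 1), P b := by
  induction L with
  | nil => simp at h
  | cons c L ih =>
    by_cases hL : ∃ a ∈ L, ¬ P a
    · obtain ⟨k, a, h1, h2, h3⟩ := ih hL
      exact ⟨k + 1, a, by simpa using h1, h2, by simpa using h3⟩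
    · push Not at hL
      refine ⟨0, c, rfl, ?_, by simpa using hL⟩
      obtain ⟨a, ha, haP⟩ := h
      rcases List.mem_cons.1 ha with rfl | ha
      · exact haP
      · exact absurd (hL a ha) haP

theorem rightmost_unique {α : Type*} {P : α → Prop} {L : List α} {k k' : ℕ} {a a' : α}
    (h : L[k]? = some a ∧ ¬ P a ∧ ∀ b ∈ L.drop (k + 1), P b)
    (h' : L[k']? = some a' ∧ ¬ P a' ∧ ∀ b ∈ L.drop (k' + 1), P b) : k = k' := by
  have key : ∀ {m m' : ℕ} {c : α}, L[m']? = some c → ¬ P c → (∀ b ∈ L.drop (m + 1), P b) →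
      ¬ m < m' := by
    intro m m' c h1 h2 h3 hlt
    refine h2 (h3 c (List.mem_iff_getElem?.2 ⟨m' - (m + 1), ?_⟩))
    rw [List.getElem?_drop, ← h1]
    congr 1
    omega
  have h1 := key h'.1 h'.2.1 h.2.2
  have h2 := key h.1 h.2.1 h'.2.2
  omega

/-- The result of a step depends on `T` and `i` alone; shape and reading together determine a
filling. -/
theorem IsStep.eq_lowerTableau {lam : Fin n → ℕ} {T T₁ : Filling n}
    (hT : IsSymplecticTableau lam T) {i : Fin n} {r : ℕ} (h : IsStep T i r T₁) :
    T₁ = lowerTableau i T := by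
  obtain ⟨k, C, x, a, b, ⟨hk, hne, hright⟩, hx, he, rfl, hb, -, hlen, hread⟩ := h
  have hpre := (hT.reading_prefix hk hne hright hx (eTilde_ne_none_iff.1 he)).2
  rw [mapIdx_eq_activeLower hpre hb, ← reading_lowerTableau] at hread
  exact eq_of_reading_eq hread (by rw [hlen, map_length_lowerTableau])

/-- The rightmost column out of place fixes `x`, `x` fixes `i` because it is a minus letter for at
most one index, and then `b` and `r` follow. -/
theorem IsStep.unique {lam : Fin n → ℕ} {T T₁ T₁' : Filling n}
    (hT : IsSymplecticTableau lam T) {i i' : Fin n} {r r' : ℕ} (h : IsStep T i r T₁)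
    (h' : IsStep T i' r' T₁') : i = i' ∧ r = r' ∧ T₁ = T₁' := by
  have e := h.eq_lowerTableau hT
  have e' := h'.eq_lowerTableau hT
  obtain ⟨k, C, x, a, b, hk, hx, he, rfl, hb, rfl, -, -⟩ := h
  obtain ⟨k', C', x', a', b', hk', hx', he', rfl, hb', rfl, -, -⟩ := h'
  obtain rfl := rightmost_unique (P := fun D : List (Letter n) => D = highestCol n D.length) hk hk'
  obtain rfl := Option.some_injective _ (hk.1.symm.trans hk'.1)
  obtain rfl := hx.unique hx'
  obtain rfl := isMinus_unique (eTilde_ne_none_iff.1 he) (eTilde_ne_none_iff.1 he')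
  obtain rfl := hb.unique hb'
  exact ⟨rfl, rfl, e.trans e'.symm⟩

theorem IsSymplecticTableau.exists_isStep {lam : Fin n → ℕ} {T : Filling n}
    (hT : IsSymplecticTableau lam T) (hne : T ≠ highestTableau lam) :
    ∃ i r T₁, IsStep T i r T₁ := by
  have hex : ∃ C ∈ T, ¬ C = highestCol n C.length := by
    by_contra hcon
    push Not at hcon
    apply hne
    rw [highestTableau, ← hT.1, List.map_map]
    conv_lhs => rw [← List.map_id T]
    exact List.map_congr_left hcon
  obtain ⟨k, C, hk, hCne, hright⟩ :=
    exists_rightmost (P := fun D : List (Letter n) => D = highestCol n D.length) hex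
  have hCT : C ∈ T := List.mem_of_getElem? hk
  have hcol := (hT.2.1 C hCT).1
  obtain ⟨p, hp, hpre, hpr⟩ := hcol.exists_prefix (hT.length_le hCT) hCne
  have hx := hcol.isLeast_isMovable hp hpre hpr
  obtain ⟨i, hi⟩ := exists_isMinus (x := C[p]) (by omega)
  obtain ⟨ha, hpre'⟩ := hT.reading_prefix hk hCne hright hx hi
  set a := (reading (T.drop (k + 1))).length + C.idxOf C[p] with ha_def
  set S : Set ℕ := {c | a ≤ c ∧ (∃ y, (reading T)[c]? = some y ∧ IsMinus i y) ∧
      ∀ d, a ≤ d → d ≤ c → ∀ z, (reading T)[d]? = some z → ¬ IsPlus i z} with hS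
  have hSne : S.Nonempty := by
    refine ⟨a, le_rfl, ⟨_, ha, hi⟩, fun d h1 h2 z hz hplus => ?_⟩
    obtain rfl := le_antisymm h1 h2
    rw [ha] at hz
    obtain rfl := Option.some_injective _ hz
    exact hplus.not_isMinus hi
  have hSb : BddAbove S := by
    refine ⟨(reading T).length, ?_⟩
    rintro c ⟨-, ⟨y, hy, -⟩, -⟩
    exact (List.getElem?_eq_some_iff.1 hy).1.le
  -- The position of `x` itself lies in `S`, and `S` is bounded by the length of the word, so the
  -- supremum is attained.
  have hb : IsGreatest S (sSup S) := ⟨Nat.sSup_mem hSne hSb, fun _ h => le_csSup hSb h⟩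
  refine ⟨i, _, lowerTableau i T, k, C, C[p], a, sSup S, ⟨hk, hCne, hright⟩, hx,
    eTilde_ne_none_iff.2 hi, rfl, hb, rfl, map_length_lowerTableau i T, ?_⟩
  rw [mapIdx_eq_activeLower hpre' hb, reading_lowerTableau]

theorem IsStep.sum_rank_lt {lam : Fin n → ℕ} {T T₁ : Filling n}
    (hT : IsSymplecticTableau lam T) {i : Fin n} {r : ℕ} (h : IsStep T i r T₁) :
    ((reading T₁).map rank).sum < ((reading T).map rank).sum := by
  rw [h.eq_lowerTableau hT, reading_lowerTableau]
  obtain ⟨k, C, x, a, b, ⟨hk, hne, hright⟩, hx, he, -⟩ := h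
  have hi := eTilde_ne_none_iff.1 he
  obtain ⟨h1, h2⟩ := hT.reading_prefix hk hne hright hx hi
  exact sum_rank_activeLower_lt h1 hi fun d hd z hz => (h2 d hd z hz).1

theorem IsStep.isSymplecticTableau {lam : Fin n → ℕ} {T T₁ : Filling n}
    (hT : IsSymplecticTableau lam T) {i : Fin n} {r : ℕ} (h : IsStep T i r T₁) :
    IsSymplecticTableau lam T₁ := by
  rw [h.eq_lowerTableau hT]
  exact isSymplecticTableau_lowerTableau hT i

/-- Strong induction on the sum of ranks of the reading; a step always exists before `T_λ` and stays
among symplectic tableaux. -/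
theorem IsSymplecticTableau.exists_isRun {lam : Fin n → ℕ} {T : Filling n}
    (hT : IsSymplecticTableau lam T) : ∃ out, IsRun lam T out := by
  induction hm : ((reading T).map rank).sum using Nat.strong_induction_on generalizing T with
  | _ m ih =>
    by_cases hne : T = highestTableau lam
    · exact ⟨[], hne ▸ IsRun.done⟩
    · obtain ⟨i, r, T₁, h⟩ := hT.exists_isStep hne
      obtain ⟨out, hout⟩ := ih _ (hm ▸ h.sum_rank_lt hT) (h.isSymplecticTableau hT) rfl
      exact ⟨_, IsRun.next hne h hout⟩

theorem IsRun.unique {lam : Fin n → ℕ} {T : Filling n} (hT : IsSymplecticTableau lam T)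
    {out out' : List (Fin n × ℕ)} (h : IsRun lam T out) (h' : IsRun lam T out') : out = out' := by
  induction h generalizing out' with
  | done =>
    cases h' with
    | done => rfl
    | next hne => exact absurd rfl hne
  | next hne hs _ ih =>
    cases h' with
    | done => exact absurd rfl hne
    | next _ hs' hr' =>
      obtain ⟨rfl, rfl, rfl⟩ := hs.unique hT hs'
      rw [ih (hs.isSymplecticTableau hT) hr']

end SymplecticTableaux

theorem mainTheorem4 (n : ℕ) (lam : Fin n → ℕ) (T : SymplecticTableaux.Filling n)
    (hT : SymplecticTableaux.IsSymplecticTableau lam T) :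
    (T ≠ SymplecticTableaux.highestTableau lam →
      (∃! p : Fin n × ℕ × SymplecticTableaux.Filling n,
        SymplecticTableaux.IsStep T p.1 p.2.1 p.2.2) ∧
      ∀ (i : Fin n) (r : ℕ) (T₁ : SymplecticTableaux.Filling n),
        SymplecticTableaux.IsStep T i r T₁ → SymplecticTableaux.IsSymplecticTableau lam T₁) ∧
    ∃! out : List (Fin n × ℕ), SymplecticTableaux.IsRun lam T out := by
  refine ⟨fun hne => ⟨?_, fun i r T₁ h => h.isSymplecticTableau hT⟩, ?_⟩
  · obtain ⟨i, r, T₁, h⟩ := hT.exists_isStep hne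
    refine ⟨(i, r, T₁), h, ?_⟩
    rintro ⟨i', r', T₁'⟩ h'
    obtain ⟨rfl, rfl, rfl⟩ := h.unique hT h'
    rfl
  · obtain ⟨out, h⟩ := hT.exists_isRun
    exact ⟨out, h, fun out' h' => h'.unique hT h⟩
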